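/- **Setting.** Finitely many robots $1,\dots,n$ move in discrete time, robot $i$ on its own locally finite graph from $q^i_{\rm start}$ to $q^i_{\rm goal}$; in each time step it traverses an edge or waits, and transitions (including waits) have costs bounded below by a positive constant. A robot rests at its goal after its path $\pi^i$ ends. A plan $\Pi=(\pi^1,\dots,\pi^n)$ has cost $|\Pi|=\sum_i|\pi^i|$ (sum of transition costs), and it is a solution if each $\pi^i$ leads from start to goal and no two robots have a vertex conflict (collision at a time $t$) or an edge conflict (collision between $t$ and $t+1$). $C^*$ is the infimum of the costs of solutions. **Framework.** The high level keeps a list OPEN of constraint-tree nodes $N$ (constraints $N.C$, paths $N.\Pi$, $N.\mathrm{cost}=|N.\Pi|$), initially the root with no constraints. It repeatedly removes a node minimizing $f_2^H$ in $\mathrm{FOCAL}=\{N\in\mathrm{OPEN}: N.\mathrm{cost}\le w^H\min_{N'\in \mathrm{OPEN}}f_1^H(N')\}$ and returns $N.\Pi$ if it has no conflict; otherwise it picks a conflict and inserts, for each of the two robots involved, a child with the additional constraint that forbids the robot its conflicting vertex or edge at that time, in which that robot is replanned by xWA* with its old path as experience (a child for which no path exists is dropped). It returns failure if OPEN is empty.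 xWA* searches over pairs (configuration, time) with FOCAL $=\{s\in\mathrm{OPEN}: f_1^L(s)\le w_2^L\min_{\rm OPEN}f_1^L\}$, $f_1^L=g+w_1^Lh$, selects a state minimizing $f_2^L$ in FOCAL, stops at the goal if there are no future constraints there, and otherwise adds to OPEN all valid successors and, if the configuration lies on the experience path (also at the start), the following part of the experience until a transition violates a constraint or an optional further termination condition holds; states are re-inserted when their $g$-value decreases. Here $h\ge 0$ is admissible, $w^H,w_1^L,w_2^L\ge1$, $w^L=w_1^Lw_2^L$, and $f_2^H,f_2^L$ are arbitrary. *Complete* means: if a solution exists, every execution (for every tie-breaking and choice of conflict) terminates and returns a solution. *$w$-sub-optimal* means: every returned plan is a solution of cost at most $w\,C^*$. **Theorem.** 1. If $f_1^H(N)\le N.\mathrm{cost}$ for every generated constraint-tree node $N$, then the framework is $w^Hw^L$-sub-optimal. If moreover no robot can be trapped (from every configuration reachable from its start its goal is reachable; this is automatic on undirected graphs when a solution exists) and the high-level FOCAL is nonempty whenever OPEN is nonempty (so that the selection rule is defined), then the framework is complete. 2. xCBS ($w^H=w_2^L=1$, $f_1^H(N)=f_2^H(N)=N.\mathrm{cost}$,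 $f_2^L=f_1^L$) is $w_1^L$-sub-optimal, and it is complete if no robot can be trapped. 3. xECBS, where $f_1^H(N)=LB(N)=\sum_i lb(i)$ with $lb(i)=\min_{s\in\mathrm{OPEN}}f_1^L(s)$ at the end of the low-level search that computed $\pi^i$, and where $f_2^H,f_2^L$ count conflicts, is $w_1^Lw_2^L$-sub-optimal for every $1\le w^H\le w_2^L$. With the high-level FOCAL threshold $w^H=w_2^L$ of ECBS it is complete if no robot can be trapped. -/

import Mathlib

universe u v

/-! ### Nondeterministic programs -/

namespace Program

variable {σ : Type u} {ρ : Type v}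

/-- Some execution from `s` halts with result `r`; `out s r` says that the program may halt in the
state `s` with result `r`. -/
def Yields (step : σ → σ → Prop) (out : σ → ρ → Prop) (s : σ) (r : ρ) : Prop :=
  ∃ s', Relation.ReflTransGen step s s' ∧ out s' r

/-- Some execution from `s` never produces a result: it runs forever, or it reaches a state that
allows neither a further step nor a result. -/
def Hangs (step : σ → σ → Prop) (out : σ → ρ → Prop) (s : σ) : Prop :=
  (∃ run : ℕ → σ, run 0 = s ∧ ∀ k, step (run k) (run (k + 1))) ∨
    ∃ s', Relation.ReflTransGen step s s' ∧ (∀ s'', ¬ step s' s'') ∧ ∀ r, ¬ out s' r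

end Program

/-! ### Multi-robot-arm motion planning as a graph search problem -/

/-- A discrete multi-robot-arm motion planning problem with `n` robots. Robot `i` moves on its own
graph: `moves i q` are the configurations that can be reached from `q` in one time step by an edge
that is free of collisions with the environment. Waiting is always possible (see `succ`).
`vertexCollides` and `edgeCollides` are the answers of the collision checker for two robots
`i < j` at two configurations, respectively during two simultaneous unit-time transitions. -/
structure MRAMP (n : ℕ) where
  Conf : Fin n → Type u
  moves : ∀ i, Conf i → Finset (Conf i)
  cost : ∀ i, Conf i → Conf i → ℝ
  start : ∀ i, Conf i
  goal : ∀ i, Conf i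
  vertexCollides : ∀ i j, Conf i → Conf j → Prop
  edgeCollides : ∀ i j, Conf i → Conf i → Conf j → Conf j → Prop

namespace MRAMP

variable {n : ℕ} (P : MRAMP.{u} n)

open Classical in
/-- What robot `i` can do in one time step: traverse an edge, or wait. -/
noncomputable def succ (i : Fin n) (q : P.Conf i) : Finset (P.Conf i) :=
  insert q (P.moves i q)

/-- A path of robot `i` from `a` to `b`: the sequence of its configurations at times
`0, 1, …, T`. -/
def IsPathFromTo (i : Fin n) (a b : P.Conf i) (π : List (P.Conf i)) : Prop :=
  π.head? = some a ∧ π.getLast? = some b ∧ π.IsChain (fun q q' => q' ∈ P.succ i q)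

/-- The cost of a path: the sum of the costs of its transitions. -/
def pathCost (i : Fin n) : List (P.Conf i) → ℝ
  | [] => 0
  | [_] => 0
  | q :: q' :: l => P.cost i q q' + pathCost i (q' :: l)

/-- One path for every robot. -/
abbrev Plan : Type u := ∀ i, List (P.Conf i)

/-- The sum of costs of a plan. -/
def planCost (S : P.Plan) : ℝ := ∑ i, P.pathCost i (S i)

/-- The configuration of robot `i` at time `t`; a robot stays at its goal once its path ended. -/
def pos (i : Fin n) (π : List (P.Conf i)) (t : ℕ) : P.Conf i := π.getD t (P.goal i)

/-- Names of possible conflicts: robots `i` and `j` collide at time `t` (vertex conflict), or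
between the times `t` and `t + 1` (edge conflict). -/
inductive Conflict (n : ℕ) where
  | vertex (i j : Fin n) (t : ℕ)
  | edge (i j : Fin n) (t : ℕ)

/-- The conflict occurs in the plan. -/
def HasConflict (S : P.Plan) : Conflict n → Prop
  | .vertex i j t => i < j ∧ P.vertexCollides i j (P.pos i (S i) t) (P.pos j (S j) t)
  | .edge i j t => i < j ∧ P.edgeCollides i j (P.pos i (S i) t) (P.pos i (S i) (t + 1))
      (P.pos j (S j) t) (P.pos j (S j) (t + 1))

/-- Every robot goes from its start to its goal, and there are no conflicts. -/
def IsSolution (S : P.Plan) : Prop :=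
  (∀ i, P.IsPathFromTo i (P.start i) (P.goal i) (S i)) ∧ ∀ k, ¬ P.HasConflict S k

/-- The optimal sum of costs `C*` (used only when there is a solution). -/
noncomputable def optCost : ℝ := sInf (P.planCost '' {S | P.IsSolution S})

/-- Transitions, including waits, have costs that are bounded below by a positive constant. -/
def PositiveCosts : Prop := ∃ δ > 0, ∀ i q, ∀ q' ∈ P.succ i q, δ ≤ P.cost i q q'

/-- No robot can get trapped: from all configurations that can be reached from its start, its goal
can be reached. -/
def NoDeadEnds : Prop := ∀ i q,
  Relation.ReflTransGen (fun a b => b ∈ P.moves i a) (P.start i) q →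
    Relation.ReflTransGen (fun a b => b ∈ P.moves i a) q (P.goal i)

/-- `vertex i q t` forbids robot `i` to be at `q` at time `t`, and `edge i q q' t` forbids it to
move from `q` to `q'` (or to wait, for `q' = q`) between the times `t` and `t + 1`. -/
inductive Constraint where
  | vertex (i : Fin n) (q : P.Conf i) (t : ℕ)
  | edge (i : Fin n) (q q' : P.Conf i) (t : ℕ)

/-- The two constraints, with the constrained robots, that resolve a conflict of a plan. -/
def constraintsOf (S : P.Plan) : Conflict n → (Fin n × P.Constraint) × (Fin n × P.Constraint)
  | .vertex i j t => ((i, .vertex i (P.pos i (S i) t) t), (j, .vertex j (P.pos j (S j) t) t))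
  | .edge i j t => ((i, .edge i (P.pos i (S i) t) (P.pos i (S i) (t + 1)) t),
      (j, .edge j (P.pos j (S j) t) (P.pos j (S j) (t + 1)) t))

/-! ### Data of the two search levels -/

/-- A search state of the low level: a configuration with time. -/
abbrev TState (i : Fin n) : Type u := P.Conf i × ℕ

/-- The data of a low-level search for robot `i`: the OPEN list, the states visited so far, their
`g`-values (meaningful for visited states only) and parent pointers. The parent of a state with
time `t + 1` has time `t`, so that its configuration is all that is stored. -/
structure LLState (i : Fin n) where
  frontier : Finset (P.TState i)
  visited : Finset (P.TState i)
  g : P.TState i → ℝ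
  parent : P.TState i → P.Conf i

/-- `ExtractPath`: follow the parent pointers from a state back to time `0`. -/
def extract {i : Fin n} (parent : P.TState i → P.Conf i) : P.Conf i → ℕ → List (P.Conf i)
  | q, 0 => [q]
  | q, t + 1 => extract parent (parent (q, t + 1)) t ++ [q]

/-- A node of the constraint tree. For each robot, `lb` is the lower bound that the low-level
search that computed its path returned together with the path. -/
structure CTNode where
  constraints : Finset P.Constraint
  paths : P.Plan
  lb : Fin n → ℝ

/-- The cost of a node: the sum of the costs of its paths. -/
def CTNode.cost {P : MRAMP.{u} n} (N : P.CTNode) : ℝ := P.planCost N.paths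

/-- `f₁ᴸ = g + w₁ h`. -/
def weightedPriority (w₁ : ℝ) (h : ∀ i, P.TState i → ℝ) (i : Fin n) (S : P.LLState i)
    (s : P.TState i) : ℝ := S.g s + w₁ * h i s

/-- The heuristic is nonnegative and never overestimates the cost of a path to the goal. -/
def Admissible (h : ∀ i, P.TState i → ℝ) : Prop :=
  ∀ i s, 0 ≤ h i s ∧ ∀ π, P.IsPathFromTo i s.1 (P.goal i) π → h i s ≤ P.pathCost i π

/-- The parameters of the framework. The priority function `f2L` and the additional termination
condition `cutoff` for adding experience may use the node whose child is being generated (`none` for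
the root node), in particular the paths of the other robots, and `f2L` may use the current search
tree of the low level. -/
structure Params where
  wH : ℝ
  w1 : ℝ
  w2 : ℝ
  h : ∀ i, P.TState i → ℝ
  f1H : P.CTNode → ℝ
  f2H : P.CTNode → EReal
  f2L : Option P.CTNode → ∀ i, P.LLState i → P.TState i → EReal
  cutoff : Option P.CTNode → ∀ i, P.TState i → P.TState i → Prop

namespace Params

variable {P} (A : P.Params)

/-! ### The low level: xWA* -/

/-- `IsEdgeValid` and `IsStateValid` for the transition from `s` to `s'`. -/
def ValidStep (i : Fin n) (C : Finset P.Constraint) (s s' : P.TState i) : Prop :=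
  s'.2 = s.2 + 1 ∧ s'.1 ∈ P.succ i s.1 ∧ Constraint.edge i s.1 s'.1 s.2 ∉ C ∧
    Constraint.vertex i s'.1 s'.2 ∉ C

open Classical in
/-- `TryInsertOrUpdate`. -/
noncomputable def tryInsert {i : Fin n} (s s' : P.TState i) (S : P.LLState i) : P.LLState i :=
  if s' ∈ S.visited → S.g s + P.cost i s.1 s'.1 < S.g s' then
    { frontier := insert s' S.frontier
      visited := insert s' S.visited
      g := Function.update S.g s' (S.g s + P.cost i s.1 s'.1)
      parent := Function.update S.parent s' s.1 }
  else S

open Classical in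
/-- `PushPartialExperience`: add the experience configurations, one time step each, until a
transition is invalid or the additional termination condition holds. -/
noncomputable def pushExperience (ctx : Option P.CTNode) (i : Fin n) (C : Finset P.Constraint) :
    List (P.Conf i) → P.TState i → P.LLState i → P.LLState i
  | [], _, S => S
  | q :: l, s, S =>
      if ValidStep i C s (q, s.2 + 1) ∧ ¬ A.cutoff ctx i s (q, s.2 + 1) then
        pushExperience ctx i C l (q, s.2 + 1) (tryInsert s (q, s.2 + 1) S)
      else S

/-- `l` is the part of the experience after an occurrence of `q`; it is empty if `q` does not
belong to the experience. -/
def SuffixAfter {i : Fin n} (experience : List (P.Conf i)) (q : P.Conf i)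
    (l : List (P.Conf i)) : Prop :=
  (∃ a, experience = a ++ q :: l) ∨ (q ∉ experience ∧ l = [])

open Classical in
/-- Add all valid successors of `s`. -/
noncomputable def pushSuccessors (i : Fin n) (C : Finset P.Constraint) (s : P.TState i)
    (S : P.LLState i) : P.LLState i :=
  (P.succ i s.1).toList.foldl
    (fun S' q => if ValidStep i C s (q, s.2 + 1) then tryInsert s (q, s.2 + 1) S' else S') S

/-- The low-level search with only the root state, before experience is added. -/
def llRoot (i : Fin n) : P.LLState i where
  frontier := {(P.start i, 0)}
  visited := {(P.start i, 0)}
  g := fun _ => 0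
  parent := fun _ => P.start i

/-- The function `f₁ᴸ` of the low level. -/
def f1L (i : Fin n) (S : P.LLState i) (s : P.TState i) : ℝ := P.weightedPriority A.w1 A.h i S s

/-- The least value of `f₁ᴸ` on OPEN (used only when OPEN is nonempty). -/
noncomputable def llMin (i : Fin n) (S : P.LLState i) : ℝ :=
  sInf (A.f1L i S '' (S.frontier : Set (P.TState i)))

/-- The FOCAL list of the low level. -/
def llFocal (i : Fin n) (S : P.LLState i) : Set (P.TState i) :=
  {s | s ∈ S.frontier ∧ A.f1L i S s ≤ A.w2 * A.llMin i S}

/-- `s` may be selected next by the low level. -/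
def LLSelects (ctx : Option P.CTNode) (i : Fin n) (S : P.LLState i) (s : P.TState i) : Prop :=
  s ∈ A.llFocal i S ∧ ∀ s' ∈ A.llFocal i S, A.f2L ctx i S s ≤ A.f2L ctx i S s'

/-- The goal test: `s` is at the goal, and there are no future constraints at the goal. -/
def IsGoalState (i : Fin n) (C : Finset P.Constraint) (s : P.TState i) : Prop :=
  s.1 = P.goal i ∧ ∀ t, s.2 ≤ t →
    Constraint.vertex i (P.goal i) t ∉ C ∧ Constraint.edge i (P.goal i) (P.goal i) t ∉ C

open Classical in
/-- The expansion of `s`, where `l` is the part of the experience after the configuration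
of `s`. -/
noncomputable def expand (ctx : Option P.CTNode) (i : Fin n) (C : Finset P.Constraint)
    (s : P.TState i) (l : List (P.Conf i)) (S : P.LLState i) : P.LLState i :=
  pushSuccessors i C s
    (A.pushExperience ctx i C l s { S with frontier := S.frontier.erase s })

/-- One step of the low level; `none` is its state before the root state is created. -/
inductive LLStep (ctx : Option P.CTNode) (i : Fin n) (C : Finset P.Constraint)
    (experience : List (P.Conf i)) : Option (P.LLState i) → Option (P.LLState i) → Prop
  | init (l : List (P.Conf i)) (hl : SuffixAfter experience (P.start i) l) :
      LLStep ctx i C experience none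
        (some (A.pushExperience ctx i C l (P.start i, 0) (llRoot i)))
  | expand (S : P.LLState i) (s : P.TState i) (l : List (P.Conf i))
      (hs : A.LLSelects ctx i S s) (hg : ¬ IsGoalState i C s)
      (hl : SuffixAfter experience s.1 l) :
      LLStep ctx i C experience (some S) (some (A.expand ctx i C s l S))

/-- The low level returns a path together with the lower bound `lb = min_{s ∈ OPEN} f₁ᴸ(s)`, or
it returns `none` when OPEN is empty. -/
inductive LLOut (ctx : Option P.CTNode) (i : Fin n) (C : Finset P.Constraint) :
    Option (P.LLState i) → Option (List (P.Conf i) × ℝ) → Prop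
  | found (S : P.LLState i) (s : P.TState i)
      (hs : A.LLSelects ctx i S s) (hg : IsGoalState i C s) :
      LLOut ctx i C (some S) (some (P.extract S.parent s.1 s.2, A.llMin i S))
  | exhausted (S : P.LLState i) (hS : S.frontier = ∅) : LLOut ctx i C (some S) none

/-- A call of the low-level planner may return `r`. -/
def LLYields (ctx : Option P.CTNode) (i : Fin n) (C : Finset P.Constraint)
    (experience : List (P.Conf i)) (r : Option (List (P.Conf i) × ℝ)) : Prop :=
  Program.Yields (A.LLStep ctx i C experience) (A.LLOut ctx i C) none r

/-- A call of the low-level planner may fail to terminate. -/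
def LLHangs (ctx : Option P.CTNode) (i : Fin n) (C : Finset P.Constraint)
    (experience : List (P.Conf i)) : Prop :=
  Program.Hangs (A.LLStep ctx i C experience) (A.LLOut ctx i C) none

/-! ### The high level -/

/-- The least value of `f₁ᴴ` on OPEN (used only when OPEN is nonempty). -/
noncomputable def hlMin (OPEN : Multiset P.CTNode) : ℝ := sInf (A.f1H '' {N | N ∈ OPEN})

/-- The FOCAL list of the high level. -/
def hlFocal (OPEN : Multiset P.CTNode) : Set P.CTNode :=
  {N | N ∈ OPEN ∧ N.cost ≤ A.wH * A.hlMin OPEN}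

/-- `N` may be selected next by the high level. -/
def HLSelects (OPEN : Multiset P.CTNode) (N : P.CTNode) : Prop :=
  N ∈ A.hlFocal OPEN ∧ ∀ N' ∈ A.hlFocal OPEN, A.f2H N ≤ A.f2H N'

open Classical in
/-- The constraint set of a child node. -/
noncomputable def childConstraints (N : P.CTNode) (c : P.Constraint) : Finset P.Constraint :=
  insert c N.constraints

/-- The child of `N` for the constraint `c` on robot `i`, after the low level returned `r`; there
is no child if no path satisfies the constraints. -/
noncomputable def child (N : P.CTNode) (i : Fin n) (c : P.Constraint) :
    Option (List (P.Conf i) × ℝ) → Multiset P.CTNode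
  | none => 0
  | some r =>
      {{ constraints := childConstraints N c
         paths := Function.update N.paths i r.1
         lb := Function.update N.lb i r.2 }}

/-- The states of the high level: before the root node is created, at the head of the main loop
with a given OPEN list, or waiting forever for a low-level call that does not terminate. -/
inductive HLState (P : MRAMP.{u} n) where
  | init
  | loop (OPEN : Multiset P.CTNode)
  | hang

open Classical in
/-- One step of the high level. The experience of a low-level call is the path of the replanned
robot in the parent node; there is no experience for the root node. -/
inductive HLStep : HLState P → HLState P → Prop
  | root (π : P.Plan) (lb : Fin n → ℝ)
      (h : ∀ i, A.LLYields none i ∅ [] (some (π i, lb i))) :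
      HLStep .init (.loop {{ constraints := ∅, paths := π, lb := lb }})
  | rootFail (i : Fin n) (h : A.LLYields none i ∅ [] none) : HLStep .init (.loop 0)
  | rootHang (i : Fin n) (h : A.LLHangs none i ∅ []) : HLStep .init .hang
  | branch (OPEN : Multiset P.CTNode) (N : P.CTNode) (hN : A.HLSelects OPEN N)
      (k : Conflict n) (hk : P.HasConflict N.paths k)
      (i j : Fin n) (c d : P.Constraint) (hc : P.constraintsOf N.paths k = ((i, c), (j, d)))
      (ri : Option (List (P.Conf i) × ℝ)) (rj : Option (List (P.Conf j) × ℝ))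
      (hi : A.LLYields (some N) i (childConstraints N c) (N.paths i) ri)
      (hj : A.LLYields (some N) j (childConstraints N d) (N.paths j) rj) :
      HLStep (.loop OPEN) (.loop (OPEN.erase N + child N i c ri + child N j d rj))
  | branchHang (OPEN : Multiset P.CTNode) (N : P.CTNode) (hN : A.HLSelects OPEN N)
      (k : Conflict n) (hk : P.HasConflict N.paths k)
      (i : Fin n) (c : P.Constraint)
      (hc : (i, c) = (P.constraintsOf N.paths k).1 ∨ (i, c) = (P.constraintsOf N.paths k).2)
      (h : A.LLHangs (some N) i (childConstraints N c) (N.paths i)) :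
      HLStep (.loop OPEN) .hang

/-- The high level returns the paths of a selected node without conflicts, or it returns `none`
when OPEN is empty. -/
inductive HLOut : HLState P → Option P.Plan → Prop
  | found (OPEN : Multiset P.CTNode) (N : P.CTNode) (hN : A.HLSelects OPEN N)
      (hk : ∀ k, ¬ P.HasConflict N.paths k) : HLOut (.loop OPEN) (some N.paths)
  | exhausted : HLOut (.loop 0) none

/-- The algorithm can reach the main loop with this OPEN list. -/
def Reaches (OPEN : Multiset P.CTNode) : Prop :=
  Relation.ReflTransGen A.HLStep .init (.loop OPEN)

/-- `N` is a node of the constraint tree of some execution. -/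
def Generated (N : P.CTNode) : Prop := ∃ OPEN, A.Reaches OPEN ∧ N ∈ OPEN

/-- The algorithm may return `r`. -/
def Returns (r : Option P.Plan) : Prop := Program.Yields A.HLStep A.HLOut .init r

/-- If there is a solution, then every execution of the algorithm terminates and returns one. -/
def Complete : Prop :=
  (∃ S, P.IsSolution S) →
    ¬ Program.Hangs A.HLStep A.HLOut .init ∧
      ∀ r, A.Returns r → ∃ S, r = some S ∧ P.IsSolution S

/-- Every plan that the algorithm may return is a solution of cost at most `w C*`. -/
def BoundedSuboptimal (w : ℝ) : Prop :=
  ∀ S, A.Returns (some S) → P.IsSolution S ∧ P.planCost S ≤ w * P.optCost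

end Params

/-! ### The instances xCBS and xECBS -/

/-- xCBS: no focal lists, and the constraint tree nodes are prioritized by their cost. -/
def xCBS (w1 : ℝ) (h : ∀ i, P.TState i → ℝ)
    (cutoff : Option P.CTNode → ∀ i, P.TState i → P.TState i → Prop) : P.Params where
  wH := 1
  w1 := w1
  w2 := 1
  h := h
  f1H := fun N => N.cost
  f2H := fun N => (N.cost : EReal)
  f2L := fun _ i S s => (P.weightedPriority w1 h i S s : EReal)
  cutoff := cutoff

/-- The number of conflicts of a node. -/
noncomputable def numConflicts (N : P.CTNode) : ℕ∞ := {k | P.HasConflict N.paths k}.encard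

/-- The conflict involves robot `i` and lies in the time interval from `0` to `T`. -/
def Conflict.InvolvesUpTo {n : ℕ} (i : Fin n) (T : ℕ) : Conflict n → Prop
  | .vertex a b t => (a = i ∨ b = i) ∧ t ≤ T
  | .edge a b t => (a = i ∨ b = i) ∧ t + 1 ≤ T

/-- The number of conflicts between the current path to `s` on the search tree of robot `i` and
the paths of the other robots; the root paths are planned without regard to other robots. -/
noncomputable def numPathConflicts (ctx : Option P.CTNode) (i : Fin n) (S : P.LLState i)
    (s : P.TState i) : ℕ∞ :=
  match ctx with
  | none => 0
  | some N => {k | P.HasConflict (Function.update N.paths i (P.extract S.parent s.1 s.2)) k ∧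
      k.InvolvesUpTo i s.2}.encard

/-- xECBS: FOCAL lists on both levels prefer fewer conflicts, and `f₁ᴴ(N)` is the sum `LB(N)` of
the lower bounds that the low level returned. -/
noncomputable def xECBS (wH w1 w2 : ℝ) (h : ∀ i, P.TState i → ℝ)
    (cutoff : Option P.CTNode → ∀ i, P.TState i → P.TState i → Prop) : P.Params where
  wH := wH
  w1 := w1
  w2 := w2
  h := h
  f1H := fun N => ∑ i, N.lb i
  f2H := fun N => ((P.numConflicts N : ENNReal) : EReal)
  f2L := fun ctx i S s => ((P.numPathConflicts ctx i S s : ENNReal) : EReal)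
  cutoff := cutoff

end MRAMP

/-!
The framework is a two-level best-first search, and both levels obey the same principle: some open
element always witnesses a bound in terms of the optimum, and focal search loses only the focal
factor against the best open element.

*Low level.* Fix a robot and a constraint set. Every change of the search tree, including the
insertion of experience, is a sequence of `tryInsert`s along valid transitions, summarized by the
relation `Extends`: whatever is inserted or improved is in OPEN afterwards. Hence the invariants of
`A*` survive (`LLInv`, `Closed`): a state that has left OPEN has relaxed all its valid successors.
On every feasible path there is therefore an open state with `f₁ ≤ w₁ · cost`
(`exists_frontier_f1L_le`), so that the returned bound `lb` is at most `w₁` times the cost of every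
feasible path, and the returned path costs at most `w₂ · lb` (`LLSpec`). For termination, the times
of expanded states are bounded (`exists_time_bound`): if a feasible path exists, the priorities of
selected states are bounded and transitions have costs at least `δ > 0`; if none exists and there
are no dead ends, then no state can survive until all constraints have expired. Among finitely many
states, each can be reinserted only finitely often, because its `g`-value decreases within a finite
set (`rank`, `sum_rank_expand_lt`).

*High level.* A solution violates at most one of the two constraints that resolve a conflict, since
it would have this conflict otherwise (`hasConflict_of_violates`). So each solution `S` remains
consistent with some open node (`HLGood`), and the paths of that node cost at most
`w₁ w₂ · |S|` while its lower bounds add up to at most `w₁ · |S|`. The focal threshold turns this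
into a bound `W · |S|` for the cost of every selected node (`FocalBound`), with `W = wᴴ w₁ w₂` for
the framework and `W = w₁ w₂` for xECBS; suboptimality follows at once
(`FocalBound.boundedSuboptimal`). For completeness (`FocalBound.complete`), the cost bound limits
the lengths of the paths of selected nodes. Robots resting at their goals do not collide if there is
a solution, so conflicts of selected nodes occur at bounded times, and their constraints lie in a
finite set (`exists_finite_constraints`). A node satisfies its constraints, except possibly those on
vertices at time `0`, which do not arise because all plans, hence also a solution, agree at time
`0`. So each branching adds new constraints, and a potential that weighs a node by `3 ^ m`, where
`m` is the number of constraints that are left, decreases.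
-/

/-! ### Termination of nondeterministic programs -/

namespace Program

variable {σ : Type u} {ρ : Type v} {step : σ → σ → Prop} {out : σ → ρ → Prop} {s : σ}

theorem invariant (I : σ → Prop) (h0 : I s) (hI : ∀ a b, I a → step a b → I b) {s' : σ}
    (h : Relation.ReflTransGen step s s') : I s' := by
  induction h with
  | refl => exact h0
  | tail _ hbc ih => exact hI _ _ ih hbc

/-- Every execution produces a result if a well-founded variant `μ` decreases in each step and
every state that satisfies the invariant `I` allows a step or a result. -/
theorem not_hangs {α : Type*} [Preorder α] [WellFoundedLT α] (I : σ → Prop) (μ : σ → α)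
    (h0 : I s) (hI : ∀ a b, I a → step a b → I b) (hμ : ∀ a b, I a → step a b → μ b < μ a)
    (hp : ∀ a, I a → (∃ b, step a b) ∨ ∃ r, out a r) : ¬ Hangs step out s := by
  rintro (⟨run, hr0, hr⟩ | ⟨s', hs', hstep, hout⟩)
  · have hrun : ∀ k, I (run k) := by
      intro k
      induction k with
      | zero => rwa [hr0]
      | succ k ih => exact hI _ _ ih (hr k)
    exact not_strictAnti_of_wellFoundedLT (fun k => μ (run k))
      (strictAnti_nat_of_succ_lt fun k => hμ _ _ (hrun k) (hr k))
  · rcases hp s' (invariant I h0 hI hs') with ⟨b, hb⟩ | ⟨r, hr⟩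
    · exact hstep b hb
    · exact hout r hr

/-- An execution that is continued as long as possible either halts with a result or hangs. -/
theorem exists_yields (h : ¬ Hangs step out s) : ∃ r, Yields step out s r := by
  by_contra hy
  simp only [Yields, not_exists, not_and] at hy
  have hnext : ∀ a : {a // Relation.ReflTransGen step s a}, ∃ b, step a.1 b := by
    rintro ⟨a, ha⟩
    by_contra hb
    exact h (Or.inr ⟨a, ha, fun b hab => hb ⟨b, hab⟩, fun r => hy r a ha⟩)
  choose f hf using hnext
  let run : ℕ → {a // Relation.ReflTransGen step s a} := fun k =>
    Nat.rec ⟨s, .refl⟩ (fun _ a => ⟨f a, a.2.tail (hf a)⟩) k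
  exact h (Or.inl ⟨fun k => (run k).1, rfl, fun k => hf (run k)⟩)

end Program

namespace MRAMP

variable {n : ℕ} {P : MRAMP.{u} n} {i : Fin n}

/-! ### Paths -/

theorem mem_succ_of_mem_moves {q q' : P.Conf i} (h : q' ∈ P.moves i q) : q' ∈ P.succ i q := by
  simp [succ, h]

theorem pathCost_concat {π : List (P.Conf i)} {p : P.Conf i} (h : π.getLast? = some p)
    (q : P.Conf i) : P.pathCost i (π ++ [q]) = P.pathCost i π + P.cost i p q := by
  induction π with
  | nil => simp at h
  | cons a l ih =>
    cases l with
    | nil =>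
      obtain rfl : a = p := by simpa using h
      simp [pathCost]
    | cons b l =>
      have := ih (by simpa using h)
      simp only [List.cons_append, pathCost] at this ⊢
      rw [this, add_assoc]

theorem length_mul_le_pathCost {δ : ℝ} (hδ : ∀ i q, ∀ q' ∈ P.succ i q, δ ≤ P.cost i q q')
    {q : P.Conf i} {l : List (P.Conf i)} (h : (q :: l).IsChain fun a b => b ∈ P.succ i a) :
    δ * l.length ≤ P.pathCost i (q :: l) := by
  induction l generalizing q with
  | nil => simp [pathCost]
  | cons b l ih =>
    rw [List.isChain_cons_cons] at h
    have h1 := ih h.2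
    have h2 := hδ i q b h.1
    simp only [pathCost, List.length_cons, Nat.cast_add, Nat.cast_one]
    linarith

theorem IsPathFromTo.length_mul_le {δ : ℝ} (hδ : ∀ i q, ∀ q' ∈ P.succ i q, δ ≤ P.cost i q q')
    {a b : P.Conf i} {π : List (P.Conf i)} (h : P.IsPathFromTo i a b π) :
    δ * (π.length - 1 : ℝ) ≤ P.pathCost i π := by
  obtain ⟨h1, -, h3⟩ := h
  cases π with
  | nil => simp at h1
  | cons q l => simpa using length_mul_le_pathCost hδ h3

theorem IsPathFromTo.pathCost_nonneg {δ : ℝ} (hδ0 : 0 < δ)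
    (hδ : ∀ i q, ∀ q' ∈ P.succ i q, δ ≤ P.cost i q q')
    {a b : P.Conf i} {π : List (P.Conf i)} (h : P.IsPathFromTo i a b π) :
    0 ≤ P.pathCost i π := by
  obtain ⟨h1, -, h3⟩ := h
  cases π with
  | nil => simp at h1
  | cons q l => exact (by positivity : 0 ≤ δ * (l.length : ℝ)).trans (length_mul_le_pathCost hδ h3)

theorem IsPathFromTo.pos_zero {a b : P.Conf i} {π : List (P.Conf i)}
    (h : P.IsPathFromTo i a b π) : P.pos i π 0 = a := by
  obtain ⟨h1, -, -⟩ := h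
  cases π with
  | nil => simp at h1
  | cons q l => simpa [pos] using h1

theorem pos_of_length_le {π : List (P.Conf i)} {t : ℕ} (h : π.length ≤ t) :
    P.pos i π t = P.goal i := by
  simp [pos, h]

open Classical in
/-- The pairs of a configuration and the cost of a walk of robot `i` that is there at time `t`.
Constraints are ignored. -/
noncomputable def layer (P : MRAMP.{u} n) (i : Fin n) : ℕ → Finset (P.Conf i × ℝ)
  | 0 => {(P.start i, 0)}
  | t + 1 => (layer P i t).biUnion fun p => (P.succ i p.1).image fun q => (q, p.2 + P.cost i p.1 q)

theorem mem_layer_succ {t : ℕ} {q q' : P.Conf i} {v : ℝ} (h : (q, v) ∈ P.layer i t)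
    (hq : q' ∈ P.succ i q) : (q', v + P.cost i q q') ∈ P.layer i (t + 1) := by
  simp only [layer, Finset.mem_biUnion, Finset.mem_image]
  exact ⟨_, h, q', hq, rfl⟩

theorem le_of_mem_layer {δ : ℝ} (hδ : ∀ i q, ∀ q' ∈ P.succ i q, δ ≤ P.cost i q q') {t : ℕ}
    {p : P.Conf i × ℝ} (h : p ∈ P.layer i t) : δ * t ≤ p.2 := by
  induction t generalizing p with
  | zero =>
    simp only [layer, Finset.mem_singleton] at h
    simp [h]
  | succ t ih =>
    simp only [layer, Finset.mem_biUnion, Finset.mem_image] at h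
    obtain ⟨a, ha, q, hq, rfl⟩ := h
    have h1 := ih ha
    have h2 := hδ i a.1 q hq
    push_cast
    linarith

theorem exists_mem_layer_pos {b : P.Conf i} {π : List (P.Conf i)}
    (h : P.IsPathFromTo i (P.start i) b π) {t : ℕ} (ht : t < π.length) :
    ∃ v, (P.pos i π t, v) ∈ P.layer i t := by
  induction t with
  | zero => exact ⟨0, by simp [h.pos_zero, layer]⟩
  | succ t ih =>
    obtain ⟨v, hv⟩ := ih (by omega)
    refine ⟨_, mem_layer_succ hv ?_⟩
    have := List.isChain_iff_getElem.1 h.2.2 t (by omega)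
    simpa [pos, ht, (by omega : t < π.length)] using this

/-- Robot `i` obeys the constraints `C` if it follows `π` and then stays at its goal. -/
def Avoids (i : Fin n) (C : Finset P.Constraint) (π : List (P.Conf i)) : Prop :=
  ∀ t, Constraint.vertex i (P.pos i π t) t ∉ C ∧
    Constraint.edge i (P.pos i π t) (P.pos i π (t + 1)) t ∉ C

namespace Params

variable {A : P.Params} {C : Finset P.Constraint} {ctx : Option P.CTNode}
  {e : List (P.Conf i)}

/-! ### Feasible completions of low-level states -/

/-- `Completion i C s c`: some continuation from the timed state `s` to a goal state respects the
constraints and has cost `c`. -/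
inductive Completion (i : Fin n) (C : Finset P.Constraint) : P.TState i → ℝ → Prop
  | goal (s : P.TState i) (h : IsGoalState i C s) : Completion i C s 0
  | step (s s' : P.TState i) (c : ℝ) (h : ValidStep i C s s') (h' : Completion i C s' c) :
      Completion i C s (P.cost i s.1 s'.1 + c)

theorem Completion.exists_path {s : P.TState i} {c : ℝ} (h : Completion i C s c) :
    ∃ l, P.IsPathFromTo i s.1 (P.goal i) (s.1 :: l) ∧ P.pathCost i (s.1 :: l) = c := by
  induction h with
  | goal s h => exact ⟨[], ⟨by simp, by simp [h.1], by simp⟩, by simp [pathCost]⟩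
  | step s s' c h _ ih =>
    obtain ⟨l, ⟨-, h2, h3⟩, h4⟩ := ih
    refine ⟨s'.1 :: l, ⟨by simp, by simpa using h2, ?_⟩, by simp [pathCost, h4]⟩
    exact List.isChain_cons_cons.2 ⟨h.2.1, h3⟩

theorem completion_of_isPathFromTo {q : P.Conf i} {π : List (P.Conf i)}
    (h : P.IsPathFromTo i q (P.goal i) π) (t : ℕ)
    (hC : ∀ t', Constraint.vertex i (P.pos i π t') (t + t') ∉ C ∧
      Constraint.edge i (P.pos i π t') (P.pos i π (t' + 1)) (t + t') ∉ C) :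
    Completion i C (q, t) (P.pathCost i π) := by
  induction π generalizing q t with
  | nil => simpa using h.1
  | cons a l ih =>
    obtain ⟨h1, h2, h3⟩ := h
    obtain rfl : a = q := by simpa using h1
    cases l with
    | nil =>
      obtain rfl : a = P.goal i := by simpa using h2
      refine .goal _ ⟨rfl, fun t' ht' => ?_⟩
      obtain ⟨d, rfl⟩ := Nat.exists_eq_add_of_le ht'
      have hp : ∀ d, P.pos i [P.goal i] d = P.goal i := by
        intro d; cases d <;> simp [pos]
      simpa [hp] using hC d
    | cons b l =>
      rw [List.isChain_cons_cons] at h3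
      have hs : ∀ d, P.pos i (a :: b :: l) (d + 1) = P.pos i (b :: l) d := fun d => by simp [pos]
      refine .step (a, t) (b, t + 1) _ ⟨rfl, h3.1, ?_, ?_⟩
        (ih ⟨by simp, by simpa using h2, h3.2⟩ (t + 1) fun d => ?_)
      · simpa [pos] using (hC 0).2
      · simpa [pos] using (hC 1).1
      · have := hC (d + 1)
        rw [hs, hs] at this
        rwa [add_assoc, add_comm 1 d]

theorem Completion.of_avoids {π : List (P.Conf i)}
    (h : P.IsPathFromTo i (P.start i) (P.goal i) π) (hC : Avoids i C π) :
    Completion i C (P.start i, 0) (P.pathCost i π) :=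
  completion_of_isPathFromTo h 0 fun t => by simpa using hC t

/-- The time from which on a constraint does not restrict any robot. -/
def expiry : P.Constraint → ℕ
  | .vertex _ _ t => t + 1
  | .edge _ _ _ t => t + 1

theorem exists_expiry (C : Finset P.Constraint) : ∃ T, ∀ c ∈ C, expiry c ≤ T :=
  ⟨C.sup expiry, fun _ hc => Finset.le_sup hc⟩

/-- After all constraints have expired, every walk to the goal is feasible. -/
theorem exists_completion_of_reaches {T : ℕ} (hT : ∀ c ∈ C, expiry c ≤ T) {q : P.Conf i}
    (h : Relation.ReflTransGen (fun a b => b ∈ P.moves i a) q (P.goal i)) {t : ℕ} (ht : T ≤ t) :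
    ∃ c, Completion i C (q, t) c := by
  have hv : ∀ q t, T ≤ t → Constraint.vertex i q t ∉ C := fun q t ht hc => by
    have := hT _ hc
    simp only [expiry] at this
    omega
  have he : ∀ q q' t, T ≤ t → Constraint.edge i q q' t ∉ C := fun q q' t ht hc => by
    have := hT _ hc
    simp only [expiry] at this
    omega
  induction h using Relation.ReflTransGen.head_induction_on generalizing t with
  | refl => exact ⟨0, .goal _ ⟨rfl, fun t' ht' => ⟨hv _ _ (ht.trans ht'), he _ _ _ (ht.trans ht')⟩⟩⟩
  | @head a b hab _ ih =>
    obtain ⟨c, hc⟩ := ih (ht.trans t.le_succ)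
    exact ⟨_, .step (a, t) (b, t + 1) c
      ⟨rfl, mem_succ_of_mem_moves hab, he _ _ _ ht, hv _ _ (ht.trans t.le_succ)⟩ hc⟩

/-! ### Invariants of the low-level search tree -/

/-- The search tree is sound: visited states descend from the start by valid steps, and `g` never
less than the cost of the current tree path. A reinsertion may leave the `g`-values of descendants
outdated, but each of them is the cost of some walk, so that there are finitely many per state. -/
structure LLInv (i : Fin n) (C : Finset P.Constraint) (S : P.LLState i) : Prop where
  frontier_subset : ∀ s ∈ S.frontier, s ∈ S.visited
  root_mem : (P.start i, 0) ∈ S.visited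
  eq_start : ∀ q, (q, 0) ∈ S.visited → q = P.start i
  tree : ∀ q t, (q, t + 1) ∈ S.visited → (S.parent (q, t + 1), t) ∈ S.visited ∧
    ValidStep i C (S.parent (q, t + 1), t) (q, t + 1) ∧
    S.g (S.parent (q, t + 1), t) + P.cost i (S.parent (q, t + 1)) q ≤ S.g (q, t + 1)
  mem_layer : ∀ s ∈ S.visited, (s.1, S.g s) ∈ P.layer i s.2

theorem LLInv.g_start {S : P.LLState i} (hS : LLInv i C S) : S.g (P.start i, 0) = 0 := by
  simpa [layer] using hS.mem_layer _ hS.root_mem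

/-- The search tree `S'` arises from `S` by insertions and updates: every state that is inserted or
whose `g`-value decreases is in OPEN afterwards, and no state enters OPEN for another reason. -/
structure Extends (S S' : P.LLState i) : Prop where
  visited : ∀ s ∈ S.visited, s ∈ S'.visited
  frontier : ∀ s ∈ S.frontier, s ∈ S'.frontier
  g_le : ∀ s ∈ S.visited, S'.g s ≤ S.g s
  g_eq : ∀ s ∈ S'.visited, s ∉ S'.frontier → s ∈ S.visited ∧ S'.g s = S.g s
  g_lt : ∀ s ∈ S.visited, s ∈ S'.frontier → s ∈ S.frontier ∨ S'.g s < S.g s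

theorem Extends.refl (S : P.LLState i) : Extends S S :=
  ⟨fun _ h => h, fun _ h => h, fun _ _ => le_rfl, fun _ h _ => ⟨h, rfl⟩, fun _ _ h => .inl h⟩

theorem Extends.trans {S S' S'' : P.LLState i} (h : Extends S S') (h' : Extends S' S'') :
    Extends S S'' where
  visited s hs := h'.visited s (h.visited s hs)
  frontier s hs := h'.frontier s (h.frontier s hs)
  g_le s hs := (h'.g_le s (h.visited s hs)).trans (h.g_le s hs)
  g_eq s hs hf := by
    obtain ⟨h1, h2⟩ := h'.g_eq s hs hf
    obtain ⟨h3, h4⟩ := h.g_eq s h1 fun hf' => hf (h'.frontier s hf')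
    exact ⟨h3, h2.trans h4⟩
  g_lt s hs hf := by
    rcases h'.g_lt s (h.visited s hs) hf with h1 | h1
    · rcases h.g_lt s hs h1 with h2 | h2
      · exact .inl h2
      · exact .inr ((h'.g_le s (h.visited s hs)).trans_lt h2)
    · exact .inr (h1.trans_le (h.g_le s hs))

theorem extends_tryInsert (s s' : P.TState i) (S : P.LLState i) :
    Extends S (tryInsert s s' S) := by
  classical
  unfold tryInsert
  split_ifs with hc
  · refine ⟨fun x hx => Finset.mem_insert_of_mem hx, fun x hx => Finset.mem_insert_of_mem hx,
      fun x hx => ?_, fun x hx hf => ?_, fun x hx hf => ?_⟩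
    · by_cases hxs : x = s'
      · subst hxs
        simpa using (hc hx).le
      · simp [hxs]
    · simp only [Finset.mem_insert, not_or] at hx hf
      exact ⟨hx.resolve_left hf.1, by simp [hf.1]⟩
    · by_cases hxs : x = s'
      · subst hxs
        exact .inr (by simpa using hc hx)
      · exact .inl (Finset.mem_of_mem_insert_of_ne hf hxs)
  · exact .refl S

/-- After `s'` was tried from `s`, it is relaxed with respect to `s`. -/
theorem tryInsert_relaxes {s s' : P.TState i} (hs : s.2 ≠ s'.2) (S : P.LLState i) :
    s' ∈ (tryInsert s s' S).visited ∧
      (tryInsert s s' S).g s' ≤ (tryInsert s s' S).g s + P.cost i s.1 s'.1 := by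
  classical
  have hne : s ≠ s' := fun h => hs (by rw [h])
  unfold tryInsert
  split_ifs with hc
  · simp [hne]
  · push Not at hc
    exact hc

theorem LLInv.tryInsert {S : P.LLState i} (hS : LLInv i C S) {s s' : P.TState i}
    (hs : s ∈ S.visited) (hv : ValidStep i C s s') : LLInv i C (tryInsert s s' S) := by
  classical
  have hext := extends_tryInsert s s' S
  unfold Params.tryInsert at hext ⊢
  split_ifs at hext ⊢ with hc
  · refine ⟨fun x hx => ?_, Finset.mem_insert_of_mem hS.root_mem, fun q hq => ?_,
      fun q t hq => ?_, fun x hx => ?_⟩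
    · simp only [Finset.mem_insert] at hx ⊢
      exact hx.imp_right (hS.frontier_subset x)
    · rcases Finset.mem_insert.1 hq with h | h
      · have := hv.1
        rw [← h] at this
        simp at this
      · exact hS.eq_start q h
    · by_cases hqs : (q, t + 1) = s'
      · subst hqs
        obtain ⟨p, t'⟩ := s
        obtain rfl : t = t' := by simpa using hv.1
        have hne : (p, t) ≠ (q, t + 1) := by simp
        refine ⟨Finset.mem_insert_of_mem (by simpa using hs), by simpa using hv, ?_⟩
        simp only [Function.update_self]
        rw [Function.update_of_ne hne]
      · obtain ⟨h1, h2, h3⟩ := hS.tree q t (Finset.mem_of_mem_insert_of_ne hq hqs)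
        simp only [Function.update_of_ne hqs]
        exact ⟨Finset.mem_insert_of_mem h1, h2, (add_le_add_left (hext.g_le _ h1) _).trans h3⟩
    · by_cases hxs : x = s'
      · subst hxs
        rw [hv.1]
        simpa using mem_layer_succ (hS.mem_layer s hs) hv.2.1
      · simpa [hxs] using hS.mem_layer x (Finset.mem_of_mem_insert_of_ne hx hxs)
  · exact hS

/-- Experience is added by insertions along valid transitions only, so that it affects neither the
soundness of the search tree nor the role of OPEN. -/
theorem pushExperience_spec (l : List (P.Conf i)) (s : P.TState i) (S : P.LLState i) :
    Extends S (A.pushExperience ctx i C l s S) ∧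
      (LLInv i C S → s ∈ S.visited → LLInv i C (A.pushExperience ctx i C l s S)) := by
  classical
  induction l generalizing s S with
  | nil => exact ⟨.refl S, fun h _ => h⟩
  | cons q l ih =>
    unfold pushExperience
    split_ifs with hc
    · obtain ⟨h1, h2⟩ := ih (q, s.2 + 1) (Params.tryInsert s (q, s.2 + 1) S)
      exact ⟨(extends_tryInsert _ _ _).trans h1, fun hS hs =>
        h2 (hS.tryInsert hs hc.1) (tryInsert_relaxes (by simp) S).1⟩
    · exact ⟨.refl S, fun h _ => h⟩

open Classical in
theorem foldl_tryInsert_spec (s : P.TState i) (L : List (P.Conf i)) (S : P.LLState i)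
    (hs : s ∈ S.visited) :
    let S' := L.foldl (fun S' q =>
      if ValidStep i C s (q, s.2 + 1) then tryInsert s (q, s.2 + 1) S' else S') S
    Extends S S' ∧ (LLInv i C S → LLInv i C S') ∧
      (s ∉ S'.frontier → ∀ q ∈ L, ValidStep i C s (q, s.2 + 1) →
        (q, s.2 + 1) ∈ S'.visited ∧ S'.g (q, s.2 + 1) ≤ S'.g s + P.cost i s.1 q) := by
  induction L generalizing S with
  | nil => exact ⟨.refl S, fun h => h, by simp⟩
  | cons a L ih =>
    simp only [List.foldl_cons]
    by_cases hv : ValidStep i C s (a, s.2 + 1)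
    · rw [if_pos hv]
      have hext := extends_tryInsert s (a, s.2 + 1) S
      have hs' := hext.visited s hs
      obtain ⟨h1, h2, h3⟩ := ih _ hs'
      refine ⟨hext.trans h1, fun hS => h2 (hS.tryInsert hs hv), fun hf q hq hq' => ?_⟩
      rcases List.mem_cons.1 hq with rfl | hq
      · -- `s` was not reinserted, so its `g`-value is still the one used for the insertion.
        obtain ⟨h4, h5⟩ := tryInsert_relaxes (s := s) (s' := (q, s.2 + 1)) (by simp) S
        refine ⟨h1.visited _ h4, (h1.g_le _ h4).trans ?_⟩
        rw [(h1.g_eq s (h1.visited s hs') hf).2]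
        exact h5
      · exact h3 hf q hq hq'
    · rw [if_neg hv]
      obtain ⟨h1, h2, h3⟩ := ih S hs
      refine ⟨h1, h2, fun hf q hq hq' => ?_⟩
      rcases List.mem_cons.1 hq with rfl | hq
      · exact absurd hq' hv
      · exact h3 hf q hq hq'

open Classical in
theorem expand_spec {S : P.LLState i} (hS : LLInv i C S) {s : P.TState i} (hs : s ∈ S.frontier)
    (l : List (P.Conf i)) :
    Extends { S with frontier := S.frontier.erase s } (A.expand ctx i C s l S) ∧
      LLInv i C (A.expand ctx i C s l S) ∧
      (s ∉ (A.expand ctx i C s l S).frontier → ∀ s', ValidStep i C s s' →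
        s' ∈ (A.expand ctx i C s l S).visited ∧
          (A.expand ctx i C s l S).g s' ≤ (A.expand ctx i C s l S).g s + P.cost i s.1 s'.1) := by
  have hS0 : LLInv i C { S with frontier := S.frontier.erase s } :=
    ⟨fun x hx => hS.frontier_subset x (Finset.mem_of_mem_erase hx), hS.root_mem, hS.eq_start,
      hS.tree, hS.mem_layer⟩
  have hsv := hS.frontier_subset s hs
  obtain ⟨h1, h2⟩ := pushExperience_spec (A := A) (ctx := ctx) (C := C) l s
    { S with frontier := S.frontier.erase s }
  obtain ⟨h3, h4, h5⟩ := foldl_tryInsert_spec (C := C) s (P.succ i s.1).toList _ (h1.visited s hsv)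
  refine ⟨h1.trans h3, h4 (h2 hS0 hsv), fun hf s' hv => ?_⟩
  obtain ⟨q, t⟩ := s'
  obtain rfl : t = s.2 + 1 := hv.1
  exact h5 hf q (Finset.mem_toList.2 hv.2.1) hv

/-- Visited states that left OPEN are not goal states, and their successors are relaxed. -/
def Closed (i : Fin n) (C : Finset P.Constraint) (S : P.LLState i) : Prop :=
  ∀ s ∈ S.visited, s ∉ S.frontier → ¬ IsGoalState i C s ∧ ∀ s', ValidStep i C s s' →
    s' ∈ S.visited ∧ S.g s' ≤ S.g s + P.cost i s.1 s'.1

theorem closed_expand {S : P.LLState i} (hS : LLInv i C S) (hC : Closed i C S) {s : P.TState i}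
    (hs : s ∈ S.frontier) (hg : ¬ IsGoalState i C s) (l : List (P.Conf i)) :
    Closed i C (A.expand ctx i C s l S) := by
  classical
  obtain ⟨h1, -, h3⟩ := expand_spec (A := A) (ctx := ctx) hS hs l
  intro x hx hf
  by_cases hxs : x = s
  · subst hxs
    exact ⟨hg, h3 hf⟩
  · obtain ⟨hx', hgx⟩ := h1.g_eq x hx hf
    have hf' : x ∉ S.frontier := fun h => hf (h1.frontier x (Finset.mem_erase.2 ⟨hxs, h⟩))
    obtain ⟨h4, h5⟩ := hC x hx' hf'
    refine ⟨h4, fun y hy => ?_⟩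
    obtain ⟨h6, h7⟩ := h5 y hy
    exact ⟨h1.visited y h6, by rw [hgx]; exact (h1.g_le y h6).trans h7⟩

theorem llInv_llRoot : LLInv i C (llRoot (P := P) i) := by
  refine ⟨fun s hs => hs, by simp [llRoot], fun q hq => ?_, fun q t hq => ?_, fun s hs => ?_⟩
  · simpa [llRoot] using hq
  · simp [llRoot] at hq
  · obtain rfl : s = (P.start i, 0) := by simpa [llRoot] using hs
    simp [llRoot, layer]

/-- The invariant of the low level. -/
def LLGood (i : Fin n) (C : Finset P.Constraint) : Option (P.LLState i) → Prop
  | none => True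
  | some S => LLInv i C S ∧ Closed i C S

theorem LLSelects.mem {S : P.LLState i} {s : P.TState i} (h : A.LLSelects ctx i S s) :
    s ∈ S.frontier := h.1.1

theorem LLGood.step {x y : Option (P.LLState i)} (hx : LLGood i C x)
    (h : A.LLStep ctx i C e x y) : LLGood i C y := by
  cases h with
  | init l hl =>
    obtain ⟨h1, h2⟩ := pushExperience_spec (A := A) (ctx := ctx) (C := C) l (P.start i, 0)
      (llRoot i)
    refine ⟨h2 llInv_llRoot (llInv_llRoot (C := C)).root_mem, fun s hs hf => ?_⟩
    exact absurd (h1.frontier s (h1.g_eq s hs hf).1) hf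
  | expand S s l hs hg hl =>
    exact ⟨(expand_spec hx.1 hs.mem l).2.1, closed_expand hx.1 hx.2 hs.mem hg l⟩

/-! ### Bounded suboptimality of the low level -/

/-- If `s` is visited and has a completion of cost `c`, then OPEN contains a state on it whose
priority is at most `g s + w₁ c`: the states before the first one in OPEN are closed, so that their
successors were relaxed. -/
theorem exists_frontier_f1L_le (hcost : P.PositiveCosts) (hw : 1 ≤ A.w1) (hh : P.Admissible A.h)
    {S : P.LLState i} (hC : Closed i C S) {s : P.TState i} {c : ℝ}
    (h : Completion i C s c) (hs : s ∈ S.visited) :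
    ∃ x ∈ S.frontier, A.f1L i S x ≤ S.g s + A.w1 * c := by
  have key : ∀ s c, Completion i C s c → s ∈ S.frontier →
      ∃ x ∈ S.frontier, A.f1L i S x ≤ S.g s + A.w1 * c := fun s c h hs => by
    obtain ⟨l, hl, rfl⟩ := h.exists_path
    refine ⟨s, hs, ?_⟩
    unfold f1L weightedPriority
    gcongr
    exact (hh i s).2 _ hl
  induction h with
  | goal s h =>
    by_cases hf : s ∈ S.frontier
    · exact key _ _ (.goal s h) hf
    · exact absurd h (hC s hs hf).1
  | step s s' c h h' ih =>
    by_cases hf : s ∈ S.frontier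
    · exact key _ _ (.step s s' c h h') hf
    · obtain ⟨h1, h2⟩ := (hC s hs hf).2 s' h
      obtain ⟨x, hx, hle⟩ := ih h1
      refine ⟨x, hx, hle.trans ?_⟩
      obtain ⟨δ, hδ0, hδ⟩ := hcost
      have hpos : 0 ≤ P.cost i s.1 s'.1 := hδ0.le.trans (hδ i _ _ h.2.1)
      nlinarith [mul_nonneg (sub_nonneg.2 hw) hpos]

theorem llMin_le {S : P.LLState i} {s : P.TState i} (hs : s ∈ S.frontier) :
    A.llMin i S ≤ A.f1L i S s :=
  csInf_le ((S.frontier.finite_toSet.image _).bddBelow) (Set.mem_image_of_mem _ hs)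

theorem exists_llMin_eq {S : P.LLState i} (hS : S.frontier.Nonempty) :
    ∃ s ∈ S.frontier, A.f1L i S s = A.llMin i S := by
  have : A.llMin i S ∈ A.f1L i S '' (S.frontier : Set (P.TState i)) :=
    Set.Nonempty.csInf_mem (Set.Nonempty.image _ hS) (S.frontier.finite_toSet.image _)
  simpa using this

theorem LLInv.g_nonneg (hcost : P.PositiveCosts) {S : P.LLState i} (hS : LLInv i C S)
    {s : P.TState i} (hs : s ∈ S.visited) : 0 ≤ S.g s := by
  obtain ⟨δ, hδ0, hδ⟩ := hcost
  exact (by positivity : 0 ≤ δ * (s.2 : ℝ)).trans (le_of_mem_layer hδ (hS.mem_layer s hs))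

theorem g_le_f1L (hw : 1 ≤ A.w1) (hh : P.Admissible A.h) (S : P.LLState i) (s : P.TState i) :
    S.g s ≤ A.f1L i S s := by
  have := mul_nonneg (zero_le_one.trans hw) (hh i s).1
  unfold f1L weightedPriority
  linarith

/-- The lower bound of the low level is at most `w₁` times the cost of every feasible path. -/
theorem llMin_le_mul (hcost : P.PositiveCosts) (hw : 1 ≤ A.w1) (hh : P.Admissible A.h)
    {S : P.LLState i} (hS : LLInv i C S) (hC : Closed i C S) {c : ℝ}
    (h : Completion i C (P.start i, 0) c) : A.llMin i S ≤ A.w1 * c := by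
  obtain ⟨x, hx, hle⟩ := exists_frontier_f1L_le hcost hw hh hC h hS.root_mem
  rw [hS.g_start, zero_add] at hle
  exact (llMin_le hx).trans hle

theorem extract_spec {S : P.LLState i} (hS : LLInv i C S) {t : ℕ} {q : P.Conf i}
    (hq : (q, t) ∈ S.visited) :
    (P.extract S.parent q t).length = t + 1 ∧
      P.IsPathFromTo i (P.start i) q (P.extract S.parent q t) ∧
      P.pathCost i (P.extract S.parent q t) ≤ S.g (q, t) ∧
      P.pos i (P.extract S.parent q t) t = q ∧
      ∀ t' < t, Constraint.edge i (P.pos i (P.extract S.parent q t) t')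
          (P.pos i (P.extract S.parent q t) (t' + 1)) t' ∉ C ∧
        Constraint.vertex i (P.pos i (P.extract S.parent q t) (t' + 1)) (t' + 1) ∉ C := by
  induction t generalizing q with
  | zero =>
    obtain rfl := hS.eq_start q hq
    refine ⟨rfl, ⟨rfl, rfl, by simp [extract]⟩, by simp [extract, pathCost, hS.g_start],
      by simp [extract, pos], by simp⟩
  | succ t ih =>
    obtain ⟨h1, h2, h3⟩ := hS.tree q t hq
    set p := S.parent (q, t + 1) with hp
    obtain ⟨hlen, hpath, hcost, hpos, hC⟩ := ih h1
    have he : P.extract S.parent q (t + 1) = P.extract S.parent p t ++ [q] := rfl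
    rw [he]
    set π := P.extract S.parent p t with hπ
    have hlt : ∀ t' ≤ t, P.pos i (π ++ [q]) t' = P.pos i π t' := fun t' ht' => by
      unfold pos
      rw [List.getD_append _ _ _ _ (by omega)]
    have hlast : P.pos i (π ++ [q]) (t + 1) = q := by
      unfold pos
      rw [List.getD_append_right _ _ _ _ (by omega)]
      simp [hlen]
    refine ⟨by simp [hlen], ⟨?_, by simp, ?_⟩, ?_, hlast, fun t' ht' => ?_⟩
    · simp [List.head?_append, hpath.1]
    · refine List.IsChain.append hpath.2.2 (by simp) fun a ha b hb => ?_
      rw [hpath.2.1] at ha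
      simp only [Option.mem_def, Option.some.injEq, List.head?_cons] at ha hb
      subst ha hb
      exact h2.2.1
    · rw [pathCost_concat hpath.2.1]
      linarith
    · rcases Nat.lt_succ_iff_lt_or_eq.1 ht' with h | rfl
      · rw [hlt t' h.le, hlt (t' + 1) h]
        exact hC t' h
      · rw [hlt t' le_rfl, hlast, hpos]
        exact h2.2.2

/-- What a path `r.1` and a lower bound `r.2` returned by the low level guarantee. A constraint
on a vertex at time `0` is not enforced by the low level. -/
structure LLSpec (A : P.Params) (i : Fin n) (C : Finset P.Constraint)
    (r : List (P.Conf i) × ℝ) : Prop where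
  path : P.IsPathFromTo i (P.start i) (P.goal i) r.1
  edge : ∀ t, Constraint.edge i (P.pos i r.1 t) (P.pos i r.1 (t + 1)) t ∉ C
  vertex : ∀ t, Constraint.vertex i (P.pos i r.1 (t + 1)) (t + 1) ∉ C
  cost_le : P.pathCost i r.1 ≤ A.w2 * r.2
  lb_le : ∀ π, P.IsPathFromTo i (P.start i) (P.goal i) π → Avoids i C π →
    r.2 ≤ A.w1 * P.pathCost i π

theorem LLYields.llSpec (hcost : P.PositiveCosts) (hw : 1 ≤ A.w1) (hh : P.Admissible A.h)
    {r : List (P.Conf i) × ℝ} (h : A.LLYields ctx i C e (some r)) : LLSpec A i C r := by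
  obtain ⟨x, hx, hout⟩ := h
  have hgood := Program.invariant (s := none) (LLGood i C) trivial (fun _ _ => LLGood.step) hx
  cases hout with
  | found S s hs hg =>
    obtain ⟨q, t⟩ := s
    obtain ⟨hlen, hpath, hle, hpos, hC⟩ :=
      extract_spec hgood.1 (hgood.1.frontier_subset _ hs.mem)
    obtain rfl : q = P.goal i := hg.1
    -- From time `t` on, the robot is at its goal.
    have hgoal : ∀ t' ≥ t, P.pos i (P.extract S.parent (P.goal i) t) t' = P.goal i := by
      intro t' ht'
      rcases ht'.eq_or_lt with rfl | h
      · exact hpos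
      · exact pos_of_length_le (by omega)
    refine ⟨hpath, fun t' => ?_, fun t' => ?_, ?_, fun π hπ hav => ?_⟩
    · rcases lt_or_ge t' t with h | h
      · exact (hC t' h).1
      · simpa only [hgoal t' h, hgoal (t' + 1) (by omega)] using (hg.2 t' h).2
    · rcases lt_or_ge t' t with h | h
      · exact (hC t' h).2
      · simpa only [hgoal (t' + 1) (by omega)] using (hg.2 (t' + 1) (by simp; omega)).1
    · exact hle.trans ((g_le_f1L hw hh S _).trans hs.1.2)
    · exact llMin_le_mul hcost hw hh hgood.1 hgood.2 (.of_avoids hπ hav)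

/-- The low level reports failure only if there is no feasible path. -/
theorem LLYields.not_avoids (hcost : P.PositiveCosts) (hw : 1 ≤ A.w1) (hh : P.Admissible A.h)
    (h : A.LLYields ctx i C e none) {π : List (P.Conf i)}
    (hπ : P.IsPathFromTo i (P.start i) (P.goal i) π) : ¬ Avoids i C π := by
  intro hav
  obtain ⟨x, hx, hout⟩ := h
  have hgood := Program.invariant (s := none) (LLGood i C) trivial (fun _ _ => LLGood.step) hx
  cases hout with
  | exhausted S hS =>
    obtain ⟨y, hy, -⟩ := exists_frontier_f1L_le hcost hw hh hgood.2 (.of_avoids hπ hav)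
      hgood.1.root_mem
    simp [hS] at hy

/-! ### Termination of the low level -/

theorem exists_completion_of_visited {S : P.LLState i} (hS : LLInv i C S) {t : ℕ} {q : P.Conf i}
    (hq : (q, t) ∈ S.visited) (h : ∃ c, Completion i C (q, t) c) :
    ∃ c, Completion i C (P.start i, 0) c := by
  induction t generalizing q with
  | zero => rwa [← hS.eq_start q hq]
  | succ t ih =>
    obtain ⟨h1, h2, -⟩ := hS.tree q t hq
    obtain ⟨c, hc⟩ := h
    exact ih h1 ⟨_, .step _ _ c h2 hc⟩

theorem reaches_of_visited {S : P.LLState i} (hS : LLInv i C S) {t : ℕ} {q : P.Conf i}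
    (hq : (q, t) ∈ S.visited) :
    Relation.ReflTransGen (fun a b => b ∈ P.moves i a) (P.start i) q := by
  induction t generalizing q with
  | zero => rw [hS.eq_start q hq]
  | succ t ih =>
    obtain ⟨h1, h2, -⟩ := hS.tree q t hq
    have hq' := h2.2.1
    simp only [succ, Finset.mem_insert] at hq'
    rcases hq' with h | h
    · rw [h]
      exact ih h1
    · exact (ih h1).tail h

/-- The low level expands states of bounded time only: if there is a feasible path then the
priorities of selected states are bounded, and otherwise, without dead ends, no state survives
until the last constraint has expired. -/
theorem exists_time_bound (hcost : P.PositiveCosts) (hw : 1 ≤ A.w1) (hw2 : 1 ≤ A.w2)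
    (hh : P.Admissible A.h) (hd : P.NoDeadEnds) (i : Fin n) (C : Finset P.Constraint) :
    ∃ M : ℕ, ∀ (ctx : Option P.CTNode) (S : P.LLState i) (s : P.TState i), LLInv i C S →
      Closed i C S → A.LLSelects ctx i S s → s.2 ≤ M := by
  by_cases hc : ∃ c, Completion i C (P.start i, 0) c
  · obtain ⟨c, hc⟩ := hc
    obtain ⟨δ, hδ0, hδ⟩ := id hcost
    refine ⟨⌊A.w2 * (A.w1 * c) / δ⌋₊, fun ctx S s hS hC hs => Nat.le_floor ?_⟩
    rw [le_div_iff₀ hδ0, mul_comm]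
    calc δ * (s.2 : ℝ) ≤ S.g s :=
          le_of_mem_layer hδ (hS.mem_layer s (hS.frontier_subset s hs.mem))
      _ ≤ A.f1L i S s := g_le_f1L hw hh S s
      _ ≤ A.w2 * A.llMin i S := hs.1.2
      _ ≤ A.w2 * (A.w1 * c) := by
          have := llMin_le_mul hcost hw hh hS hC hc
          gcongr
  · obtain ⟨T, hT⟩ := exists_expiry C
    refine ⟨T, fun ctx S s hS hC hs => ?_⟩
    by_contra hlt
    have hv := hS.frontier_subset s hs.mem
    exact hc (exists_completion_of_visited hS hv
      (exists_completion_of_reaches hT (hd i _ (reaches_of_visited hS hv)) (not_le.1 hlt).le))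

open Classical in
/-- A bound for the number of future insertions and removals of `s`: every reinsertion decreases
`g s`, which takes values in a finite set. -/
noncomputable def rank (S : P.LLState i) (s : P.TState i) : ℕ :=
  if s ∈ S.visited then
    2 * ((P.layer i s.2).filter fun p => p.2 < S.g s).card + if s ∈ S.frontier then 1 else 0
  else 2 * (P.layer i s.2).card + 2

theorem Extends.rank_le {S S' : P.LLState i} (h : Extends S S') (hS' : LLInv i C S')
    (s : P.TState i) : rank S' s ≤ rank S s := by
  classical
  unfold rank
  by_cases hs : s ∈ S.visited
  · have hs' := h.visited s hs
    rw [if_pos hs, if_pos hs']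
    rcases (h.g_le s hs).lt_or_eq with hlt | heq
    · have : ((P.layer i s.2).filter fun p => p.2 < S'.g s).card <
          ((P.layer i s.2).filter fun p => p.2 < S.g s).card := by
        refine Finset.card_lt_card (Finset.ssubset_iff_of_subset ?_ |>.2
          ⟨_, Finset.mem_filter.2 ⟨hS'.mem_layer s hs', hlt⟩, by simp⟩)
        exact Finset.monotone_filter_right _ fun p _ hp => hp.trans hlt
      split_ifs <;> omega
    · rw [heq]
      by_cases hf : s ∈ S'.frontier
      · have : s ∈ S.frontier := (h.g_lt s hs hf).resolve_right heq.not_lt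
        simp [this, hf]
      · simp [hf]
  · rw [if_neg hs]
    have := Finset.card_filter_le (P.layer i s.2) fun p => p.2 < S'.g s
    split_ifs <;> omega

open Classical in
/-- The states of time at most `M` that can be reached without regard to constraints. -/
noncomputable def statesUpTo (P : MRAMP.{u} n) (i : Fin n) (M : ℕ) : Finset (P.TState i) :=
  (Finset.range (M + 1)).biUnion fun t => (P.layer i t).image fun p => (p.1, t)

theorem LLInv.mem_statesUpTo {S : P.LLState i} (hS : LLInv i C S) {M : ℕ} {s : P.TState i}
    (hs : s ∈ S.visited) (hM : s.2 ≤ M) : s ∈ statesUpTo P i M := by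
  simp only [statesUpTo, Finset.mem_biUnion, Finset.mem_range, Finset.mem_image]
  exact ⟨s.2, by omega, _, hS.mem_layer s hs, rfl⟩

theorem sum_rank_expand_lt {S : P.LLState i} (hS : LLInv i C S) {M : ℕ} {s : P.TState i}
    (hs : s ∈ S.frontier) (hM : s.2 ≤ M) (l : List (P.Conf i)) :
    ∑ x ∈ statesUpTo P i M, rank (A.expand ctx i C s l S) x <
      ∑ x ∈ statesUpTo P i M, rank S x := by
  classical
  obtain ⟨h1, h2, -⟩ := expand_spec (A := A) (ctx := ctx) hS hs l
  have hsv := hS.frontier_subset s hs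
  refine Finset.sum_lt_sum (fun x _ => (h1.rank_le h2 x).trans ?_)
    ⟨s, hS.mem_statesUpTo hsv hM, (h1.rank_le h2 s).trans_lt ?_⟩
  · by_cases hx : x ∈ S.visited
    · simp only [rank, hx, if_true, Finset.mem_erase]
      split_ifs <;> first | omega | tauto
    · simp [rank, hx]
  · simp [rank, hsv, hs]

theorem exists_suffixAfter (e : List (P.Conf i)) (q : P.Conf i) : ∃ l, SuffixAfter e q l := by
  by_cases h : q ∈ e
  · obtain ⟨a, l, h⟩ := List.append_of_mem h
    exact ⟨l, .inl ⟨a, h⟩⟩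
  · exact ⟨[], .inr ⟨h, rfl⟩⟩

theorem exists_llSelects (hcost : P.PositiveCosts) (hw : 1 ≤ A.w1) (hw2 : 1 ≤ A.w2)
    (hh : P.Admissible A.h) {S : P.LLState i} (hS : LLInv i C S) (hne : S.frontier.Nonempty)
    (ctx : Option P.CTNode) : ∃ s, A.LLSelects ctx i S s := by
  obtain ⟨s, hs, heq⟩ := exists_llMin_eq (A := A) hne
  have h0 : 0 ≤ A.llMin i S := by
    rw [← heq]
    exact (hS.g_nonneg hcost (hS.frontier_subset s hs)).trans (g_le_f1L hw hh S s)
  have hfin : (A.llFocal i S).Finite := S.frontier.finite_toSet.subset fun x hx => hx.1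
  obtain ⟨m, hm, hmin⟩ := hfin.exists_minimalFor (A.f2L ctx i S) _
    ⟨s, hs, by rw [heq]; exact le_mul_of_one_le_left h0 hw2⟩
  exact ⟨m, hm, fun x hx => (le_total (A.f2L ctx i S m) _).elim id fun h => hmin hx h⟩

theorem not_llHangs (hcost : P.PositiveCosts) (hw : 1 ≤ A.w1) (hw2 : 1 ≤ A.w2)
    (hh : P.Admissible A.h) (hd : P.NoDeadEnds) (ctx : Option P.CTNode) (i : Fin n)
    (C : Finset P.Constraint) (e : List (P.Conf i)) : ¬ A.LLHangs ctx i C e := by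
  obtain ⟨M, hM⟩ := exists_time_bound hcost hw hw2 hh hd i C
  let μ : Option (P.LLState i) → ℕ∞
    | none => ⊤
    | some S => ((∑ x ∈ statesUpTo P i M, rank S x : ℕ) : ℕ∞)
  refine Program.not_hangs (LLGood i C) μ trivial (fun _ _ => LLGood.step) (fun x y hx h => ?_)
    fun x hx => ?_
  · cases h with
    | init l hl => exact ENat.natCast_lt_top _
    | expand S s l hs hg hl =>
      exact Nat.cast_lt.2 (sum_rank_expand_lt hx.1 hs.mem (hM ctx S s hx.1 hx.2 hs) l)
  · cases x with
    | none =>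
      obtain ⟨l, hl⟩ := exists_suffixAfter e (P.start i)
      exact .inl ⟨_, .init l hl⟩
    | some S =>
      rcases S.frontier.eq_empty_or_nonempty with h | h
      · exact .inr ⟨_, .exhausted S h⟩
      · obtain ⟨s, hs⟩ := exists_llSelects hcost hw hw2 hh hx.1 h ctx
        by_cases hg : IsGoalState i C s
        · exact .inr ⟨_, .found S s hs hg⟩
        · obtain ⟨l, hl⟩ := exists_suffixAfter e s.1
          exact .inl ⟨_, .expand S s l hs hg hl⟩

end Params

end MRAMP

namespace MRAMP

variable {n : ℕ} {P : MRAMP.{u} n}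

/-! ### Conflicts and constraints -/

/-- The plan does what the constraint forbids. -/
def Violates (S : P.Plan) : P.Constraint → Prop
  | .vertex i q t => P.pos i (S i) t = q
  | .edge i q q' t => P.pos i (S i) t = q ∧ P.pos i (S i) (t + 1) = q'

/-- The plan respects all constraints. -/
def Consistent (C : Finset P.Constraint) (S : P.Plan) : Prop := ∀ c ∈ C, ¬ Violates S c

/-- The robot that the constraint is about. -/
def Constraint.robot : P.Constraint → Fin n
  | .vertex i _ _ => i
  | .edge i _ _ _ => i

/-- The time at which the conflict occurs or begins. -/
def Conflict.time : Conflict n → ℕ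
  | .vertex _ _ t => t
  | .edge _ _ t => t

theorem Consistent.avoids {C : Finset P.Constraint} {S : P.Plan} (h : Consistent C S)
    (i : Fin n) : Avoids i C (S i) :=
  fun _ => ⟨fun hc => h _ hc rfl, fun hc => h _ hc ⟨rfl, rfl⟩⟩

theorem constraintsOf_spec {S : P.Plan} {k : Conflict n} {i : Fin n} {c : P.Constraint}
    (h : (i, c) = (P.constraintsOf S k).1 ∨ (i, c) = (P.constraintsOf S k).2) :
    c.robot = i ∧ Violates S c ∧ Params.expiry c = k.time + 1 := by
  cases k <;> simp only [constraintsOf, Prod.mk.injEq] at h <;>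
    rcases h with ⟨rfl, rfl⟩ | ⟨rfl, rfl⟩ <;>
    exact ⟨rfl, by simp [Violates], rfl⟩

theorem constraintsOf_ne_vertex_zero {S S₀ : P.Plan} (hS₀ : P.IsSolution S₀)
    (hS : ∀ i, P.IsPathFromTo i (P.start i) (P.goal i) (S i)) {k : Conflict n}
    (hk : P.HasConflict S k) {i : Fin n} {c : P.Constraint}
    (h : (i, c) = (P.constraintsOf S k).1 ∨ (i, c) = (P.constraintsOf S k).2)
    (j : Fin n) (q : P.Conf j) : c ≠ .vertex j q 0 := by
  rintro rfl
  cases k with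
  | vertex a b t =>
    obtain rfl : t = 0 := by
      simpa [Params.expiry, Conflict.time] using (constraintsOf_spec h).2.2.symm
    -- All plans agree at time `0`, so that `S₀` has the same conflict.
    refine hS₀.2 (.vertex a b 0) ⟨hk.1, ?_⟩
    simpa only [(hS _).pos_zero, (hS₀.1 _).pos_zero] using hk.2
  | edge =>
    simp only [constraintsOf, Prod.mk.injEq] at h
    rcases h with ⟨-, h⟩ | ⟨-, h⟩ <;> cases h

/-- A plan that does what both constraints forbid has the conflict that they resolve. -/
theorem hasConflict_of_violates {S S' : P.Plan} {k : Conflict n} (hk : P.HasConflict S k)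
    {i j : Fin n} {c d : P.Constraint} (hc : P.constraintsOf S k = ((i, c), (j, d)))
    (h1 : Violates S' c) (h2 : Violates S' d) : P.HasConflict S' k := by
  cases k <;> simp only [constraintsOf, Prod.mk.injEq] at hc <;>
    obtain ⟨⟨rfl, rfl⟩, ⟨rfl, rfl⟩⟩ := hc <;>
    simp only [Violates] at h1 h2 <;>
    simp only [HasConflict, h1, h2] <;> exact hk

/-- All conflicts begin before the last path has ended: robots that rest at their goals do not
collide, as they would in the solution `S₀` too. -/
theorem HasConflict.time_lt {S S₀ : P.Plan} (hS₀ : P.IsSolution S₀) {k : Conflict n}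
    (hk : P.HasConflict S k) {T : ℕ} (hT : ∀ i, (S i).length ≤ T) : k.time < T := by
  by_contra hle
  rw [not_lt] at hle
  cases k with
  | vertex a b t =>
    simp only [Conflict.time] at hle
    refine hS₀.2 (.vertex a b (max (S₀ a).length (S₀ b).length)) ⟨hk.1, ?_⟩
    rw [pos_of_length_le (le_max_left _ _), pos_of_length_le (le_max_right _ _)]
    have := hk.2
    rwa [pos_of_length_le ((hT a).trans hle), pos_of_length_le ((hT b).trans hle)] at this
  | edge a b t =>
    simp only [Conflict.time] at hle
    have h1 := le_max_left (S₀ a).length (S₀ b).length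
    have h2 := le_max_right (S₀ a).length (S₀ b).length
    refine hS₀.2 (.edge a b (max (S₀ a).length (S₀ b).length)) ⟨hk.1, ?_⟩
    rw [pos_of_length_le h1, pos_of_length_le h2, pos_of_length_le (h1.trans (Nat.le_succ _)),
      pos_of_length_le (h2.trans (Nat.le_succ _))]
    have := hk.2
    have ha := (hT a).trans hle
    have hb := (hT b).trans hle
    rwa [pos_of_length_le ha, pos_of_length_le hb, pos_of_length_le (ha.trans (Nat.le_succ _)),
      pos_of_length_le (hb.trans (Nat.le_succ _))] at this

/-- Only finitely many constraints of bounded time can arise from conflicts of plans. -/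
theorem finite_violated (P : MRAMP.{u} n) (T : ℕ) :
    {c : P.Constraint | Params.expiry c ≤ T ∧ ∃ S : P.Plan,
      (∀ i, P.IsPathFromTo i (P.start i) (P.goal i) (S i)) ∧ Violates S c}.Finite := by
  let Q : ∀ i, Set (P.Conf i) := fun i =>
    insert (P.goal i) (⋃ t ∈ Set.Iic T, Prod.fst '' (P.layer i t : Set (P.Conf i × ℝ)))
  have hQ : ∀ i, (Q i).Finite := fun i => Set.Finite.insert _
    ((Set.finite_Iic T).biUnion fun t _ => (P.layer i t).finite_toSet.image _)
  have hpos : ∀ i π, P.IsPathFromTo i (P.start i) (P.goal i) π → ∀ t ≤ T, P.pos i π t ∈ Q i := by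
    intro i π hπ t ht
    rcases lt_or_ge t π.length with h | h
    · obtain ⟨v, hv⟩ := exists_mem_layer_pos hπ h
      exact Set.mem_insert_of_mem _ (Set.mem_biUnion (Set.mem_Iic.2 ht) ⟨_, hv, rfl⟩)
    · rw [pos_of_length_le h]
      exact Set.mem_insert _ _
  refine ((Set.finite_iUnion fun i => ((hQ i).prod (Set.finite_Iic T)).image
      fun p : P.Conf i × ℕ => Constraint.vertex i p.1 p.2).union
    (Set.finite_iUnion fun i => (((hQ i).prod (hQ i)).prod (Set.finite_Iic T)).image
      fun p : (P.Conf i × P.Conf i) × ℕ => Constraint.edge i p.1.1 p.1.2 p.2)).subset ?_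
  rintro c ⟨ht, S, hS, hv⟩
  cases c with
  | vertex i q t =>
    have ht' : t + 1 ≤ T := ht
    obtain rfl := hv
    exact .inl (Set.mem_iUnion.2 ⟨i, (_, t), ⟨hpos i _ (hS i) t (by omega), by simp; omega⟩, rfl⟩)
  | edge i q q' t =>
    have ht' : t + 1 ≤ T := ht
    obtain ⟨rfl, rfl⟩ := hv
    exact .inr (Set.mem_iUnion.2 ⟨i, ((_, _), t), ⟨⟨hpos i _ (hS i) t (by omega),
      hpos i _ (hS i) (t + 1) ht'⟩, by simp; omega⟩, rfl⟩)

namespace Params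

variable {A : P.Params}

/-! ### Invariants of the constraint tree -/

/-- The paths and lower bounds of the node have the guarantees of the low level for all constraints
of the node, including those that were added after a path was computed. -/
def NodeInv (A : P.Params) (N : P.CTNode) : Prop :=
  ∀ i, LLSpec A i N.constraints (N.paths i, N.lb i)

theorem mem_childConstraints {N : P.CTNode} {c d : P.Constraint} :
    d ∈ childConstraints N c ↔ d = c ∨ d ∈ N.constraints := by
  simp [childConstraints]

theorem LLSpec.childConstraints {N : P.CTNode} {i : Fin n} {r : List (P.Conf i) × ℝ}
    (h : LLSpec A i N.constraints r) {c : P.Constraint} (hc : c.robot ≠ i) :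
    LLSpec A i (childConstraints N c) r := by
  refine ⟨h.path, fun t ht => ?_, fun t ht => ?_, h.cost_le, fun π hπ hav =>
    h.lb_le π hπ fun t => ?_⟩
  · rcases mem_childConstraints.1 ht with rfl | ht
    · exact hc rfl
    · exact h.edge t ht
  · rcases mem_childConstraints.1 ht with rfl | ht
    · exact hc rfl
    · exact h.vertex t ht
  · exact ⟨fun h => (hav t).1 (mem_childConstraints.2 (.inr h)),
      fun h => (hav t).2 (mem_childConstraints.2 (.inr h))⟩

theorem NodeInv.child (hcost : P.PositiveCosts) (hw : 1 ≤ A.w1) (hh : P.Admissible A.h)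
    {N : P.CTNode} (hN : NodeInv A N) {i : Fin n} {c : P.Constraint} (hc : c.robot = i)
    {r : Option (List (P.Conf i) × ℝ)}
    (hr : A.LLYields (some N) i (childConstraints N c) (N.paths i) r) :
    ∀ N' ∈ child N i c r, NodeInv A N' := by
  cases r with
  | none => simp [Params.child]
  | some r =>
    intro N' hN' j
    obtain rfl := Multiset.mem_singleton.1 hN'
    by_cases hj : j = i
    · subst hj
      simpa using hr.llSpec hcost hw hh
    · simpa [hj] using (hN j).childConstraints fun h => hj (h.symm.trans hc)

theorem NodeInv.path {N : P.CTNode} (hN : NodeInv A N) (i : Fin n) :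
    P.IsPathFromTo i (P.start i) (P.goal i) (N.paths i) := (hN i).path

/-- A node violates none of its constraints, apart from those on vertices at time `0`, which the
low level does not check. -/
theorem NodeInv.eq_vertex_zero {N : P.CTNode} (hN : NodeInv A N) {c : P.Constraint}
    (hc : c ∈ N.constraints) (hv : Violates N.paths c) : ∃ i q, c = .vertex i q 0 := by
  cases c with
  | vertex i q t =>
    obtain rfl := hv
    cases t with
    | zero => exact ⟨_, _, rfl⟩
    | succ t => exact absurd hc ((hN i).vertex t)
  | edge i q q' t =>
    obtain ⟨rfl, rfl⟩ := hv
    exact absurd hc ((hN i).edge t)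

theorem NodeInv.sum_lb_le {N : P.CTNode} (hN : NodeInv A N) {S : P.Plan} (hS : P.IsSolution S)
    (hC : Consistent N.constraints S) : ∑ i, N.lb i ≤ A.w1 * P.planCost S := by
  rw [planCost, Finset.mul_sum]
  exact Finset.sum_le_sum fun i _ => (hN i).lb_le _ (hS.1 i) (hC.avoids i)

theorem NodeInv.cost_le_sum_lb {N : P.CTNode} (hN : NodeInv A N) :
    N.cost ≤ A.w2 * ∑ i, N.lb i := by
  rw [CTNode.cost, planCost, Finset.mul_sum]
  exact Finset.sum_le_sum fun i _ => (hN i).cost_le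

theorem NodeInv.cost_le (hw2 : 1 ≤ A.w2) {N : P.CTNode} (hN : NodeInv A N) {S : P.Plan}
    (hS : P.IsSolution S) (hC : Consistent N.constraints S) :
    N.cost ≤ A.w1 * A.w2 * P.planCost S := by
  have := mul_le_mul_of_nonneg_left (hN.sum_lb_le hS hC) (zero_le_one.trans hw2)
  linarith [hN.cost_le_sum_lb]

theorem planCost_nonneg (hcost : P.PositiveCosts) {S : P.Plan}
    (hS : ∀ i, P.IsPathFromTo i (P.start i) (P.goal i) (S i)) : 0 ≤ P.planCost S := by
  obtain ⟨δ, hδ0, hδ⟩ := hcost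
  exact Finset.sum_nonneg fun i _ => (hS i).pathCost_nonneg hδ0 hδ

/-- The high-level invariant: the nodes of OPEN are sound, and every solution is consistent with
one of them. -/
def HLGood (A : P.Params) : HLState P → Prop
  | .init => True
  | .hang => True
  | .loop OPEN => (∀ N ∈ OPEN, NodeInv A N) ∧
      ∀ S, P.IsSolution S → ∃ N ∈ OPEN, Consistent N.constraints S

theorem HLSelects.mem {OPEN : Multiset P.CTNode} {N : P.CTNode} (h : A.HLSelects OPEN N) :
    N ∈ OPEN := h.1.1

theorem exists_child_consistent (hcost : P.PositiveCosts) (hw : 1 ≤ A.w1) (hh : P.Admissible A.h)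
    {N : P.CTNode} {S : P.Plan} (hS : P.IsSolution S) (hC : Consistent N.constraints S)
    {i : Fin n} {c : P.Constraint} (hc : ¬ Violates S c) {r : Option (List (P.Conf i) × ℝ)}
    (hr : A.LLYields (some N) i (childConstraints N c) (N.paths i) r) :
    ∃ N' ∈ child N i c r, Consistent N'.constraints S := by
  have hC' : Consistent (Params.childConstraints N c) S := fun d hd => by
    rcases mem_childConstraints.1 hd with rfl | hd
    · exact hc
    · exact hC d hd
  cases r with
  | none => exact absurd (hC'.avoids i) (hr.not_avoids hcost hw hh (hS.1 i))
  | some r => exact ⟨_, Multiset.mem_singleton_self _, hC'⟩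

theorem HLGood.step (hcost : P.PositiveCosts) (hw : 1 ≤ A.w1) (hh : P.Admissible A.h)
    {x y : HLState P} (hx : HLGood A x) (h : A.HLStep x y) : HLGood A y := by
  classical
  cases h with
  | root π lb h =>
    refine ⟨fun N hN i => ?_, fun S hS => ⟨_, Multiset.mem_singleton_self _, by simp [Consistent]⟩⟩
    obtain rfl := Multiset.mem_singleton.1 hN
    exact (h i).llSpec hcost hw hh
  | rootFail i h =>
    exact ⟨by simp, fun S hS =>
      absurd (fun t => by simp) (h.not_avoids hcost hw hh (hS.1 i))⟩
  | rootHang i h => trivial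
  | branchHang => trivial
  | branch OPEN N hN k hk i j c d hc ri rj hi hj =>
    have hinv := hx.1 N hN.mem
    have hci : (i, c) = (P.constraintsOf N.paths k).1 := by rw [hc]
    have hdj : (j, d) = (P.constraintsOf N.paths k).2 := by rw [hc]
    refine ⟨fun N' hN' => ?_, fun S hS => ?_⟩
    · rcases Multiset.mem_add.1 hN' with h | h
      · rcases Multiset.mem_add.1 h with h | h
        · exact hx.1 N' (Multiset.mem_of_mem_erase h)
        · exact hinv.child hcost hw hh (constraintsOf_spec (.inl hci)).1 hi N' h
      · exact hinv.child hcost hw hh (constraintsOf_spec (.inr hdj)).1 hj N' h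
    · obtain ⟨N₀, hN₀, hC⟩ := hx.2 S hS
      by_cases hne : N₀ = N
      · subst hne
        by_cases hv : Violates S c
        · obtain ⟨N', hN', h⟩ := exists_child_consistent hcost hw hh hS hC
            (fun hv' => hS.2 k (hasConflict_of_violates hk hc hv hv')) hj
          exact ⟨N', Multiset.mem_add.2 (.inr hN'), h⟩
        · obtain ⟨N', hN', h⟩ := exists_child_consistent hcost hw hh hS hC hv hi
          exact ⟨N', Multiset.mem_add.2 (.inl (Multiset.mem_add.2 (.inr hN'))), h⟩
      · exact ⟨N₀, Multiset.mem_add.2 (.inl (Multiset.mem_add.2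
          (.inl ((Multiset.mem_erase_of_ne hne).2 hN₀)))), hC⟩

theorem hlGood_of_reflTransGen (hcost : P.PositiveCosts) (hw : 1 ≤ A.w1) (hh : P.Admissible A.h)
    {x : HLState P} (hx : Relation.ReflTransGen A.HLStep .init x) : HLGood A x :=
  Program.invariant (s := HLState.init) (HLGood A) (by trivial)
    (fun _ _ => HLGood.step hcost hw hh) hx

/-! ### Bounded suboptimality and completeness of the high level -/

/-- The focal list guarantees the factor `W`: every node that may be selected costs at most `W`
times as much as each solution that is consistent with a node of OPEN. -/
def FocalBound (A : P.Params) (W : ℝ) : Prop :=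
  ∀ OPEN, A.Reaches OPEN → (∀ N ∈ OPEN, NodeInv A N) → ∀ N ∈ A.hlFocal OPEN, ∀ N' ∈ OPEN,
    ∀ S, P.IsSolution S → Consistent N'.constraints S → N.cost ≤ W * P.planCost S

theorem FocalBound.cost_le (hcost : P.PositiveCosts) (hw : 1 ≤ A.w1) (hh : P.Admissible A.h)
    {W : ℝ} (hW : FocalBound A W) {OPEN : Multiset P.CTNode} (hO : A.Reaches OPEN)
    {N : P.CTNode} (hN : A.HLSelects OPEN N) {S : P.Plan} (hS : P.IsSolution S) :
    N.cost ≤ W * P.planCost S := by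
  obtain ⟨h1, h2⟩ := hlGood_of_reflTransGen hcost hw hh hO
  obtain ⟨N', hN', hC⟩ := h2 S hS
  exact hW OPEN hO h1 N hN.1 N' hN' S hS hC

theorem FocalBound.boundedSuboptimal (hcost : P.PositiveCosts) (hw : 1 ≤ A.w1)
    (hh : P.Admissible A.h) {W : ℝ} (hW0 : 0 < W) (hW : FocalBound A W) :
    A.BoundedSuboptimal W := by
  rintro S ⟨x, hx, hout⟩
  cases hout with
  | found OPEN N hN hk =>
    have hsol : P.IsSolution N.paths :=
      ⟨((hlGood_of_reflTransGen hcost hw hh hx).1 N hN.mem).path, hk⟩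
    refine ⟨hsol, ?_⟩
    rw [mul_comm, ← div_le_iff₀ hW0]
    refine le_csInf ⟨_, Set.mem_image_of_mem _ hsol⟩ ?_
    rintro _ ⟨S, hS, rfl⟩
    rw [div_le_iff₀ hW0, mul_comm]
    exact hW.cost_le hcost hw hh hx hN hS

/-- The constraints that resolve a conflict of a selected node are new, and they belong to a finite
set that depends only on the cost bound. -/
theorem exists_finite_constraints (hcost : P.PositiveCosts) {S₀ : P.Plan}
    (hS₀ : P.IsSolution S₀) (B : ℝ) :
    ∃ F : Finset P.Constraint, ∀ (A : P.Params) (N : P.CTNode), NodeInv A N → N.cost ≤ B →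
      ∀ k, P.HasConflict N.paths k → ∀ i c, ((i, c) = (P.constraintsOf N.paths k).1 ∨
        (i, c) = (P.constraintsOf N.paths k).2) → c ∈ F ∧ c ∉ N.constraints := by
  obtain ⟨δ, hδ0, hδ⟩ := hcost
  refine ⟨(finite_violated P (⌊B / δ⌋₊ + 1)).toFinset, fun A N hN hB k hk i c hc => ?_⟩
  obtain ⟨-, hv, ht⟩ := constraintsOf_spec hc
  refine ⟨(Set.Finite.mem_toFinset _).2 ⟨?_, N.paths, hN.path, hv⟩, fun hmem => ?_⟩
  · rw [ht]
    refine hk.time_lt hS₀ fun a => ?_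
    have h1 : δ * ((N.paths a).length - 1 : ℝ) ≤ B :=
      ((hN.path a).length_mul_le hδ).trans ((Finset.single_le_sum
        (fun j _ => (hN.path j).pathCost_nonneg hδ0 hδ) (Finset.mem_univ a)).trans hB)
    rw [mul_comm, ← le_div_iff₀ hδ0] at h1
    have h2 := Nat.lt_floor_add_one (B / δ)
    have h3 : ((N.paths a).length : ℝ) < ((⌊B / δ⌋₊ + 1 + 1 : ℕ) : ℝ) := by
      push_cast
      linarith
    exact Nat.lt_succ_iff.1 (Nat.cast_lt.1 h3)
  · obtain ⟨j, q, h⟩ := hN.eq_vertex_zero hmem hv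
    exact constraintsOf_ne_vertex_zero hS₀ hN.path hk hc j q h

/-- The potential of OPEN: a node that can receive `m` more constraints weighs `3 ^ m`, more than
its two children together. -/
def weight (K : ℕ) (OPEN : Multiset P.CTNode) : ℕ :=
  (OPEN.map fun N => 3 ^ (K - N.constraints.card)).sum

theorem weight_child_le (K : ℕ) {N : P.CTNode} {i : Fin n} {c : P.Constraint}
    (hc : c ∉ N.constraints) (r : Option (List (P.Conf i) × ℝ)) :
    weight K (child N i c r) ≤ 3 ^ (K - (N.constraints.card + 1)) := by
  cases r with
  | none => simp [weight, child]
  | some r => simp [weight, child, Params.childConstraints, hc]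

open Classical in
theorem weight_branch_lt {F : Finset P.Constraint} {OPEN : Multiset P.CTNode} {N : P.CTNode}
    (hN : N ∈ OPEN) (hF : N.constraints ⊆ F) {i j : Fin n} {c d : P.Constraint}
    (hc : c ∈ F ∧ c ∉ N.constraints) (hd : d ∉ N.constraints)
    (ri : Option (List (P.Conf i) × ℝ)) (rj : Option (List (P.Conf j) × ℝ)) :
    weight F.card (OPEN.erase N + child N i c ri + child N j d rj) < weight F.card OPEN := by
  have h1 : weight F.card OPEN =
      3 ^ (F.card - N.constraints.card) + weight F.card (OPEN.erase N) := by
    conv_lhs => rw [← Multiset.cons_erase hN]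
    simp [weight]
  have h2 := weight_child_le F.card hc.2 ri
  have h3 := weight_child_le F.card hd rj
  have h4 : N.constraints.card < F.card :=
    Finset.card_lt_card ((Finset.ssubset_iff_of_subset hF).2 ⟨c, hc⟩)
  have h5 : 3 ^ (F.card - N.constraints.card) = 3 * 3 ^ (F.card - (N.constraints.card + 1)) := by
    rw [← pow_succ']
    congr 1
    omega
  have h6 : 0 < 3 ^ (F.card - (N.constraints.card + 1)) := by positivity
  have h7 : weight F.card (OPEN.erase N + child N i c ri + child N j d rj) =
      weight F.card (OPEN.erase N) + weight F.card (child N i c ri) +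
        weight F.card (child N j d rj) := by
    simp [weight]
  omega

theorem constraints_subset_of_mem_child {F : Finset P.Constraint} {N N' : P.CTNode} {i : Fin n}
    {c : P.Constraint} {r : Option (List (P.Conf i) × ℝ)} (hN : N.constraints ⊆ F) (hc : c ∈ F)
    (h : N' ∈ child N i c r) : N'.constraints ⊆ F := by
  cases r with
  | none => simp [child] at h
  | some r =>
    obtain rfl := Multiset.mem_singleton.1 h
    intro d hd
    rcases mem_childConstraints.1 hd with rfl | hd
    · exact hc
    · exact hN hd

theorem finite_mem (OPEN : Multiset P.CTNode) : {N | N ∈ OPEN}.Finite := by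
  classical
  exact OPEN.toFinset.finite_toSet.subset fun N hN => by simpa using hN

theorem exists_hlSelects {OPEN : Multiset P.CTNode} (h : (A.hlFocal OPEN).Nonempty) :
    ∃ N, A.HLSelects OPEN N := by
  have hfin : (A.hlFocal OPEN).Finite := (finite_mem OPEN).subset fun N hN => hN.1
  obtain ⟨N, hN, hmin⟩ := hfin.exists_minimalFor A.f2H _ h
  exact ⟨N, hN, fun N' hN' => (le_total (A.f2H N) _).elim id fun h => hmin hN' h⟩

theorem FocalBound.complete (hcost : P.PositiveCosts) (hw : 1 ≤ A.w1) (hw2 : 1 ≤ A.w2)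
    (hh : P.Admissible A.h) (hd : P.NoDeadEnds) {W : ℝ} (hW : FocalBound A W)
    (hfocal : ∀ OPEN, A.Reaches OPEN → OPEN ≠ 0 → (A.hlFocal OPEN).Nonempty) : A.Complete := by
  classical
  rintro ⟨S₀, hS₀⟩
  have hLL : ∀ ctx i C e, ¬ A.LLHangs ctx i C e := not_llHangs hcost hw hw2 hh hd
  refine ⟨?_, ?_⟩
  · obtain ⟨F, hF⟩ := exists_finite_constraints hcost hS₀ (W * P.planCost S₀)
    have hnew : ∀ {OPEN N}, A.Reaches OPEN → A.HLSelects OPEN N → ∀ k, P.HasConflict N.paths k →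
        ∀ i c, ((i, c) = (P.constraintsOf N.paths k).1 ∨
          (i, c) = (P.constraintsOf N.paths k).2) → c ∈ F ∧ c ∉ N.constraints :=
      fun hO hN => hF A _ ((hlGood_of_reflTransGen hcost hw hh hO).1 _ hN.mem)
        (hW.cost_le hcost hw hh hO hN hS₀)
    let I : HLState P → Prop
      | .init => True
      | .hang => False
      | .loop OPEN => A.Reaches OPEN ∧ ∀ N ∈ OPEN, N.constraints ⊆ F
    let μ : HLState P → ℕ∞
      | .init => ⊤
      | .hang => 0
      | .loop OPEN => (weight F.card OPEN : ℕ∞)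
    refine Program.not_hangs I μ trivial (fun x y hx h => ?_) (fun x y hx h => ?_) fun x hx => ?_
    · cases h with
      | root π lb h =>
        exact ⟨.single (.root π lb h), fun N hN => by simp [Multiset.mem_singleton.1 hN]⟩
      | rootFail i h => exact ⟨.single (.rootFail i h), by simp⟩
      | rootHang i h => exact hLL _ _ _ _ h
      | branchHang OPEN N hN k hk i c hc h => exact hLL _ _ _ _ h
      | branch OPEN N hN k hk i j c d hc ri rj hi hj =>
        have h1 := hnew hx.1 hN k hk i c (.inl (by rw [hc]))
        have h2 := hnew hx.1 hN k hk j d (.inr (by rw [hc]))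
        refine ⟨hx.1.tail (.branch OPEN N hN k hk i j c d hc ri rj hi hj), fun N' hN' => ?_⟩
        rcases Multiset.mem_add.1 hN' with h | h
        · rcases Multiset.mem_add.1 h with h | h
          · exact hx.2 N' (Multiset.mem_of_mem_erase h)
          · exact constraints_subset_of_mem_child (hx.2 N hN.mem) h1.1 h
        · exact constraints_subset_of_mem_child (hx.2 N hN.mem) h2.1 h
    · cases h with
      | root π lb h => exact ENat.natCast_lt_top _
      | rootFail i h => exact ENat.natCast_lt_top _
      | rootHang i h => exact absurd h (hLL _ _ _ _)
      | branchHang OPEN N hN k hk i c hc h => exact absurd h (hLL _ _ _ _)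
      | branch OPEN N hN k hk i j c d hc ri rj hi hj =>
        have h1 := hnew hx.1 hN k hk i c (.inl (by rw [hc]))
        have h2 := hnew hx.1 hN k hk j d (.inr (by rw [hc]))
        exact Nat.cast_lt.2 (weight_branch_lt hN.mem (hx.2 N hN.mem) h1 h2.2 ri rj)
    · cases x with
      | init =>
        choose r hr using fun i => Program.exists_yields (hLL none i ∅ [])
        by_cases h : ∃ i, r i = none
        · obtain ⟨i, hi⟩ := h
          exact .inl ⟨_, .rootFail i (hi ▸ hr i)⟩
        · simp only [not_exists, ← ne_eq, Option.ne_none_iff_exists'] at h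
          choose p hp using h
          exact .inl ⟨_, .root (fun i => (p i).1) (fun i => (p i).2) fun i => hp i ▸ hr i⟩
      | hang => exact hx.elim
      | loop OPEN =>
        by_cases hO : OPEN = 0
        · subst hO
          exact .inr ⟨_, .exhausted⟩
        · obtain ⟨N, hN⟩ := exists_hlSelects (hfocal OPEN hx.1 hO)
          by_cases hk : ∃ k, P.HasConflict N.paths k
          · obtain ⟨k, hk⟩ := hk
            rcases hc : P.constraintsOf N.paths k with ⟨⟨i, c⟩, ⟨j, d⟩⟩
            obtain ⟨ri, hi⟩ := Program.exists_yields
              (hLL (some N) i (childConstraints N c) (N.paths i))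
            obtain ⟨rj, hj⟩ := Program.exists_yields
              (hLL (some N) j (childConstraints N d) (N.paths j))
            exact .inl ⟨_, .branch OPEN N hN k hk i j c d hc ri rj hi hj⟩
          · exact .inr ⟨_, .found OPEN N hN (not_exists.1 hk)⟩
  · rintro r ⟨x, hx, hout⟩
    have hgood := hlGood_of_reflTransGen hcost hw hh hx
    cases hout with
    | found OPEN N hN hk => exact ⟨_, rfl, (hgood.1 N hN.mem).path, hk⟩
    | exhausted =>
      obtain ⟨N, hN, -⟩ := hgood.2 S₀ hS₀
      simp at hN

/-! ### The focal lists of the framework and of its instances -/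

theorem hlMin_le {OPEN : Multiset P.CTNode} {N : P.CTNode} (hN : N ∈ OPEN) :
    A.hlMin OPEN ≤ A.f1H N :=
  csInf_le ((finite_mem OPEN).image _).bddBelow (Set.mem_image_of_mem _ hN)

theorem exists_hlMin_eq {OPEN : Multiset P.CTNode} (h : OPEN ≠ 0) :
    ∃ N ∈ OPEN, A.f1H N = A.hlMin OPEN := by
  have : A.hlMin OPEN ∈ A.f1H '' {N | N ∈ OPEN} :=
    Set.Nonempty.csInf_mem (Set.Nonempty.image _ (Multiset.exists_mem_of_ne_zero h))
      ((finite_mem OPEN).image _)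
  simpa using this

theorem focalBound_of_f1H_le_cost (hwH : 1 ≤ A.wH) (hw2 : 1 ≤ A.w2)
    (hf : ∀ N, A.Generated N → A.f1H N ≤ N.cost) :
    FocalBound A (A.wH * (A.w1 * A.w2)) := by
  intro OPEN hO hinv N hN N' hN' S hS hC
  calc N.cost ≤ A.wH * A.hlMin OPEN := hN.2
    _ ≤ A.wH * (A.w1 * A.w2 * P.planCost S) := by
        gcongr
        exact (hlMin_le hN').trans ((hf N' ⟨OPEN, hO, hN'⟩).trans ((hinv N' hN').cost_le hw2 hS hC))
    _ = A.wH * (A.w1 * A.w2) * P.planCost S := by ring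

end Params

theorem focalBound_xECBS (hcost : P.PositiveCosts) {wH w1 w2 : ℝ} (hwH : 1 ≤ wH) (hw : wH ≤ w2)
    (hw1 : 1 ≤ w1) (h : ∀ i, P.TState i → ℝ)
    (cutoff : Option P.CTNode → ∀ i, P.TState i → P.TState i → Prop) :
    Params.FocalBound (P.xECBS wH w1 w2 h cutoff) (w1 * w2) := by
  intro OPEN hO hinv N hN N' hN' S hS hC
  have h0 : 0 ≤ P.planCost S := Params.planCost_nonneg hcost hS.1
  calc N.cost ≤ wH * (P.xECBS wH w1 w2 h cutoff).hlMin OPEN := hN.2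
    _ ≤ wH * (w1 * P.planCost S) := by
        gcongr
        exact (Params.hlMin_le hN').trans ((hinv N' hN').sum_lb_le hS hC)
    _ ≤ w2 * (w1 * P.planCost S) := by gcongr
    _ = w1 * w2 * P.planCost S := by ring

end MRAMP

theorem mainTheorem2 {n : ℕ} (P : MRAMP.{u} n) (hcost : P.PositiveCosts) :
    -- the framework
    (∀ A : P.Params, 1 ≤ A.wH → 1 ≤ A.w1 → 1 ≤ A.w2 → P.Admissible A.h →
      (∀ N, A.Generated N → A.f1H N ≤ N.cost) →
        A.BoundedSuboptimal (A.wH * (A.w1 * A.w2)) ∧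
        (P.NoDeadEnds → (∀ OPEN, A.Reaches OPEN → OPEN ≠ 0 → (A.hlFocal OPEN).Nonempty) →
          A.Complete)) ∧
    ∀ (w1 w2 : ℝ) (h : ∀ i, P.TState i → ℝ)
      (cutoff : Option P.CTNode → ∀ i, P.TState i → P.TState i → Prop),
      1 ≤ w1 → 1 ≤ w2 → P.Admissible h →
      -- xCBS
      ((P.xCBS w1 h cutoff).BoundedSuboptimal w1 ∧
        (P.NoDeadEnds → (P.xCBS w1 h cutoff).Complete)) ∧
      -- xECBS
      ((∀ wH, 1 ≤ wH → wH ≤ w2 → (P.xECBS wH w1 w2 h cutoff).BoundedSuboptimal (w1 * w2)) ∧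
        (P.NoDeadEnds → (P.xECBS w2 w1 w2 h cutoff).Complete)) := by
  refine ⟨fun A hwH hw1 hw2 hh hf => ?_, fun w1 w2 h cutoff hw1 hw2 hh => ⟨?_, ?_, fun hd => ?_⟩⟩
  · have hW := MRAMP.Params.focalBound_of_f1H_le_cost hwH hw2 hf
    exact ⟨hW.boundedSuboptimal hcost hw1 hh (by positivity),
      fun hd => hW.complete hcost hw1 hw2 hh hd⟩
  · have hW := MRAMP.Params.focalBound_of_f1H_le_cost (A := P.xCBS w1 h cutoff) le_rfl le_rfl
      fun N _ => le_rfl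
    have hW' : MRAMP.Params.FocalBound (P.xCBS w1 h cutoff) w1 := by
      simpa [MRAMP.xCBS] using hW
    refine ⟨hW'.boundedSuboptimal hcost hw1 hh (by positivity), fun hd =>
      hW'.complete hcost hw1 le_rfl hh hd fun OPEN _ hne => ?_⟩
    obtain ⟨N, hN, heq⟩ := MRAMP.Params.exists_hlMin_eq (A := P.xCBS w1 h cutoff) hne
    exact ⟨N, hN, by rw [← heq]; exact (one_mul _).ge⟩
  · exact fun wH hwH hle => (MRAMP.focalBound_xECBS hcost hwH hle hw1 h cutoff).boundedSuboptimal
      hcost hw1 hh (by positivity)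
  · refine (MRAMP.focalBound_xECBS hcost hw2 le_rfl hw1 h cutoff).complete hcost hw1 hw2 hh hd
      fun OPEN hO hne => ?_
    have hinv := (MRAMP.Params.hlGood_of_reflTransGen hcost hw1 hh hO).1
    obtain ⟨N, hN, heq⟩ := MRAMP.Params.exists_hlMin_eq (A := P.xECBS w2 w1 w2 h cutoff) hne
    exact ⟨N, hN, by rw [← heq]; exact (hinv N hN).cost_le_sum_lb⟩
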